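/- Let $\mathcal X$ be a measurable space and let $(X,Y)$ be a random pair with law $D$ on $\mathcal X\times\{+1,-1\}$; put $\pi_+=\Pr(Y=+1)$ and $\pi_-=\Pr(Y=-1)$. Let $(X',Y')$ be an independent copy of $(X,Y)$. A pairwise comparison is a pair $(x,x')$ whose law $\tilde p$ is the conditional law of $(X,X')$ given $(Y,Y')\in\{(+1,-1),(+1,+1),(-1,-1)\}$. In terms of the class-conditional laws $p_\pm$ of $X$ given $Y=\pm1$, this law is $\tilde p(x,x')=\big(\pi_+^2p_+(x)p_+(x')+\pi_-^2p_-(x)p_-(x')+\pi_+\pi_-p_+(x)p_-(x')\big)/(\pi_+^2+\pi_-^2+\pi_+\pi_-)$. Let $\tilde p_+$ and $\tilde p_-$ be the marginal laws of $x$ and of $x'$ under $\tilde p$. Let $\ell:\mathbb R\times\{+1,-1\}\to[0,\infty)$ be a loss function, let $R(f)=\mathbb E_{(x,y)\sim D}[\ell(f(x),y)]$ and, for a sample $(x_1,x_1'),\dots,(x_n,x_n')$ drawn i.i.d. from $\tilde p$ ($n\ge 1$), let $$\hat R_{\mathrm{PC}}(f)=\frac1n\sum_{i=1}^n\big(\ell(f(x_i),+1)+\ell(f(x_i'),-1)-\pi_+\ell(f(x_i),-1)-\pi_-\ell(f(x_i'),+1)\big).$$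 Let $\mathcal F$ be a class of measurable functions $\mathcal X\to\mathbb R$ for which the suprema below are measurable functions of the sample, and let $$\tilde{\mathfrak R}^\pm_n(\mathcal F)=\mathbb E_{z_1,\dots,z_n\sim\tilde p_\pm\text{ i.i.d.}}\ \mathbb E_{\sigma}\Big[\sup_{f\in\mathcal F}\frac1n\sum_{i=1}^n\sigma_if(z_i)\Big]$$ be its Rademacher complexities, where $\sigma_1,\dots,\sigma_n$ are independent uniform random signs. Theorem. Suppose that $\ell$ is $\rho$-Lipschitz in its first argument ($0\le\rho<\infty$), that there is a constant $C_b>0$ with $|f(x)|\le C_b$ for all $f\in\mathcal F$ and $x\in\mathcal X$, and that $f^\star\in\mathcal F$ minimizes $R$ over $\mathcal F$. Let $C_\ell=\sup_{|z|\le C_b,\ t=\pm1}\ell(z,t)$. Then for every $\delta>0$, with probability at least $1-\delta$ over the sample, every minimizer $\hat f_{\mathrm{PC}}$ of $\hat R_{\mathrm{PC}}$ over $\mathcal F$ satisfies $$R(\hat f_{\mathrm{PC}})-R(f^\star)\le(1+\pi_+)4\rho\,\tilde{\mathfrak R}^+_n(\mathcal F)+(1+\pi_-)4\rho\,\tilde{\mathfrak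 R}^-_n(\mathcal F)+6C_\ell\sqrt{\frac{\log(8/\delta)}{2n}}.$$ -/

import Mathlib

open MeasureTheory ProbabilityTheory
open scoped NNReal

noncomputable section

namespace Pcomp

/-- All sets of labels are measurable. -/
instance discreteLabels : DiscreteMeasurableSpace ℤˣ := by
  have : MeasurableSingletonClass ℤˣ :=
    ⟨fun t => ⟨{(t : ℤ)}, measurableSet_singleton _, by ext s; simp [Units.ext_iff]⟩⟩
  infer_instance

/-- The set of binary labels is `{+1, -1}`, realized as `ℤˣ`. A joint law of an instance and its
label is a probability measure `D` on `X × ℤˣ`. This is the class prior `p(y = t)`. -/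
def classPrior {X : Type*} [MeasurableSpace X] (D : Measure (X × ℤˣ)) (t : ℤˣ) : ℝ :=
  D.real {p | p.2 = t}

/-- The classification risk `R(f) = E_{(x, y) ∼ D} [ℓ(f(x), y)]`. -/
def risk {X : Type*} [MeasurableSpace X] (D : Measure (X × ℤˣ)) (l : ℝ → ℤˣ → ℝ)
    (f : X → ℝ) : ℝ :=
  ∫ p, l (f p.1) p.2 ∂D

/-- Pairs of labelled instances whose labels `(y, y')` are one of
`(+1, -1)`, `(+1, +1)`, `(-1, -1)`. -/
def acceptedPairs (X : Type*) : Set ((X × ℤˣ) × (X × ℤˣ)) :=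
  {q | (q.1.2, q.2.2) ∈ ({(1, -1), (1, 1), (-1, -1)} : Set (ℤˣ × ℤˣ))}

/-- The law of one pairwise comparison `(x, x')`: two labelled instances are drawn
independently from `D`, conditioned on their labels being accepted, and the labels are dropped. -/
def pairLaw {X : Type*} [MeasurableSpace X] (D : Measure (X × ℤˣ)) : Measure (X × X) :=
  ((D.prod D)[|acceptedPairs X]).map (fun q => (q.1.1, q.2.1))

/-- The pointwise law of the first component `x` of a pairwise comparison. -/
def posLaw {X : Type*} [MeasurableSpace X] (D : Measure (X × ℤˣ)) : Measure X :=
  (pairLaw D).map Prod.fst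

/-- The pointwise law of the second component `x'` of a pairwise comparison. -/
def negLaw {X : Type*} [MeasurableSpace X] (D : Measure (X × ℤˣ)) : Measure X :=
  (pairLaw D).map Prod.snd

/-- The law of a data set of `n` i.i.d. pairwise comparisons. -/
def sampleLaw {X : Type*} [MeasurableSpace X] (D : Measure (X × ℤˣ)) (n : ℕ) :
    Measure (Fin n → X × X) :=
  Measure.pi (fun _ => pairLaw D)

/-- The empirical Pcomp risk of `f` on the pairwise comparisons `S i = (x_i, x_i')`. -/
def empRisk {X : Type*} [MeasurableSpace X] (D : Measure (X × ℤˣ)) (l : ℝ → ℤˣ → ℝ)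
    {n : ℕ} (S : Fin n → X × X) (f : X → ℝ) : ℝ :=
  (1 / (n : ℝ)) * ∑ i, (l (f (S i).1) 1 + l (f (S i).2) (-1)
    - classPrior D 1 * l (f (S i).1) (-1) - classPrior D (-1) * l (f (S i).2) 1)

/-- `g` minimizes the functional `J` over the model class `F`. -/
def IsArgmin {X : Type*} (F : Set (X → ℝ)) (J : (X → ℝ) → ℝ) (g : X → ℝ) : Prop :=
  g ∈ F ∧ ∀ f ∈ F, J g ≤ J f

/-- The supremum over `f ∈ F` of `(1/n) ∑ i, σ i * f (x i)`, for a vector `σ` of signs. -/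
def signedSup {X : Type*} (F : Set (X → ℝ)) {n : ℕ} (σ : Fin n → ℤˣ) (x : Fin n → X) : ℝ :=
  ⨆ f : F, (1 / (n : ℝ)) * ∑ i, ((σ i : ℤ) : ℝ) * f.1 (x i)

/-- The (expected) Rademacher complexity of `F` with sample size `n` over `μ`: the expectation of
`signedSup F σ x` over `x ∼ μⁿ` and independent uniform signs `σ`. -/
def rademacher {X : Type*} [MeasurableSpace X] (μ : Measure X) (n : ℕ) (F : Set (X → ℝ)) : ℝ :=
  (1 / (2 : ℝ) ^ n) * ∑ σ : Fin n → ℤˣ, ∫ x, signedSup F σ x ∂(Measure.pi fun _ : Fin n => μ)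

/-- The suprema in the Rademacher complexity are random variables, so that their expectations
make sense. -/
def RademacherMeasurable {X : Type*} [MeasurableSpace X] (μ : Measure X) (n : ℕ)
    (F : Set (X → ℝ)) : Prop :=
  ∀ σ : Fin n → ℤˣ, AEMeasurable (signedSup F σ) (Measure.pi fun _ : Fin n => μ)

/-- The largest loss `sup {ℓ(z, t) : |z| ≤ C, t = ±1}`. -/
def lossSup (l : ℝ → ℤˣ → ℝ) (C : ℝ) : ℝ :=
  sSup {r | ∃ z t, |z| ≤ C ∧ r = l z t}

end Pcomp

end

/-!
The corrected losses `ℓ(·, t) - π_t ℓ(·, -t)` invert the mixing of the two class-conditional laws in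
the law of a comparison, so the empirical risk is unbiased (`integral_pairLoss`), and each comparison
contributes a summand whose range has length at most `(1 + π₊) C + (1 + π₋) C = 3 C`, where `C` is
the largest loss. For a minimizer `f̂` of the empirical risk `R̂`,
`R(f̂) - R(f⋆) ≤ (R(f̂) - R̂(f̂)) + (R̂(f⋆) - R(f⋆))`. Both terms are controlled by McDiarmid's
inequality (`measure_ge_le_of_ae_boundedDifferences`), the first through `sup (R - R̂)` over the
class, whose mean is bounded by symmetrization and contraction.

Only the suprema in the Rademacher complexities are assumed measurable. The supremum of `R - R̂`, and
the signed suprema of the loss class, need not be, so the argument runs through measurable majorants: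

* The least measurable majorant of a function with bounded differences has almost surely bounded
  differences (`exists_measurable_envelope`, `exists_measurableSet_deviation_le`), which suffices
  for McDiarmid's inequality.
* Symmetrization only needs majorants of the signed suprema for each sign vector separately
  (`exists_measurable_majorant_deviation`).
* Contraction yields such majorants (`exists_measurable_majorant_contraction`): on a piece of
  the sample space where the measurable signed suprema of the class are almost constant, the finite
  dimensional contraction principle (`sum_iSup_signed_sum_le`) is applied to all functions and all
  samples of the piece together.
-/

namespace Pcomp

/-! ### Least measurable majorants -/

/-- A measurable real function with values in `[-B, B]` is integrable. -/
theorem integrable_of_abs_le {α : Type*} [MeasurableSpace α] {μ : Measure α} [IsFiniteMeasure μ]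
    {g : α → ℝ} {B : ℝ} (hg : Measurable g) (hB : ∀ x, |g x| ≤ B) : Integrable g μ :=
  .of_bound hg.aestronglyMeasurable B (.of_forall hB)

/-- Every bounded function has a least measurable majorant, up to null sets: the infimum of a
sequence of measurable majorants whose integrals tend to the smallest possible value. -/
theorem exists_measurable_envelope {α : Type*} [MeasurableSpace α] (μ : Measure α)
    [IsProbabilityMeasure μ] {Φ : α → ℝ} {B : ℝ} (hΦ : ∀ x, |Φ x| ≤ B) :
    ∃ g : α → ℝ, Measurable g ∧ (∀ x, Φ x ≤ g x) ∧ (∀ x, |g x| ≤ B) ∧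
      ∀ h : α → ℝ, Measurable h → (∀ x, Φ x ≤ h x) → g ≤ᵐ[μ] h := by
  let A : Set ℝ := {r | ∃ h : α → ℝ, Measurable h ∧ (∀ x, Φ x ≤ h x) ∧ (∀ x, |h x| ≤ B) ∧
    r = ∫ x, h x ∂μ}
  obtain ⟨x₀⟩ : Nonempty α := nonempty_of_isProbabilityMeasure μ
  have hB : 0 ≤ B := (abs_nonneg _).trans (hΦ x₀)
  have hne : A.Nonempty :=
    ⟨_, fun _ => B, measurable_const, fun x => (le_abs_self _).trans (hΦ x),
      fun _ => (abs_of_nonneg hB).le, rfl⟩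
  have hbdd : BddBelow A := by
    refine ⟨-B, ?_⟩
    rintro _ ⟨h, hm, -, hb, rfl⟩
    have := integral_mono (μ := μ) (integrable_const (-B)) (integrable_of_abs_le hm hb)
      (fun x => (abs_le.1 (hb x)).1)
    simpa using this
  have hseq : ∀ k : ℕ, ∃ h : α → ℝ, Measurable h ∧ (∀ x, Φ x ≤ h x) ∧ (∀ x, |h x| ≤ B) ∧
      ∫ x, h x ∂μ < sInf A + 1 / ((k : ℝ) + 1) := by
    intro k
    obtain ⟨_, ⟨h, h1, h2, h3, rfl⟩, hlt⟩ :=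
      exists_lt_of_csInf_lt hne (lt_add_of_pos_right (sInf A) (Nat.one_div_pos_of_nat (n := k)))
    exact ⟨h, h1, h2, h3, hlt⟩
  choose h hm hΦh hhB hlt using hseq
  have hbb : ∀ x, BddBelow (Set.range fun k => h k x) := fun x =>
    ⟨-B, by rintro _ ⟨k, rfl⟩; exact (abs_le.1 (hhB k x)).1⟩
  let g : α → ℝ := fun x => ⨅ k, h k x
  have hgm : Measurable g := Measurable.iInf hm
  have hΦg : ∀ x, Φ x ≤ g x := fun x => le_ciInf fun k => hΦh k x
  have hgB : ∀ x, |g x| ≤ B := fun x => abs_le.2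
    ⟨(abs_le.1 (hΦ x)).1.trans (hΦg x), (ciInf_le (hbb x) 0).trans (abs_le.1 (hhB 0 x)).2⟩
  have hgint : ∫ x, g x ∂μ ≤ sInf A := by
    refine le_of_tendsto_of_tendsto' tendsto_const_nhds
      (?_ : Filter.Tendsto (fun k : ℕ => sInf A + 1 / ((k : ℝ) + 1)) Filter.atTop _) fun k => ?_
    · simpa using tendsto_const_nhds.add (tendsto_one_div_add_atTop_nhds_zero_nat (𝕜 := ℝ))
    · exact (integral_mono (integrable_of_abs_le hgm hgB) (integrable_of_abs_le (hm k) (hhB k))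
        fun x => ciInf_le (hbb x) k).trans (hlt k).le
  refine ⟨g, hgm, hΦg, hgB, fun f hf hΦf => ?_⟩
  -- `min g f` is another majorant, so its integral is not smaller than that of `g`.
  have hmB : ∀ x, |min (g x) (f x)| ≤ B := fun x => abs_le.2
    ⟨(abs_le.1 (hΦ x)).1.trans (le_min (hΦg x) (hΦf x)),
      (min_le_left _ _).trans (abs_le.1 (hgB x)).2⟩
  have hmm : Measurable fun x => min (g x) (f x) := hgm.min hf
  have hle : ∫ x, g x ∂μ ≤ ∫ x, min (g x) (f x) ∂μ :=
    hgint.trans (csInf_le hbdd ⟨_, hmm, fun x => le_min (hΦg x) (hΦf x), hmB, rfl⟩)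
  have hig := integrable_of_abs_le (μ := μ) hgm hgB
  have him := integrable_of_abs_le (μ := μ) hmm hmB
  have h0 : ∫ x, (g x - min (g x) (f x)) ∂μ = 0 := by
    refine le_antisymm ?_ (integral_nonneg fun x => sub_nonneg.2 (min_le_left _ _))
    rw [integral_sub hig him]
    linarith
  rw [integral_eq_zero_iff_of_nonneg (fun x => sub_nonneg.2 (min_le_left _ _)) (hig.sub him)] at h0
  filter_upwards [h0] with x hx
  have : g x = min (g x) (f x) := sub_eq_zero.1 hx
  rw [this]
  exact min_le_right _ _

/-! ### McDiarmid's inequality -/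

theorem measurePreserving_cons {Ω : Type*} [MeasurableSpace Ω] (μ : Measure Ω)
    [IsProbabilityMeasure μ] (n : ℕ) :
    MeasurePreserving (fun p : (Fin n → Ω) × Ω => (Fin.cons p.2 p.1 : Fin (n + 1) → Ω))
      ((Measure.pi fun _ : Fin n => μ).prod μ) (Measure.pi fun _ : Fin (n + 1) => μ) := by
  have h := (measurePreserving_piFinSuccAbove (fun _ : Fin (n + 1) => μ) 0).symm.comp
    (Measure.measurePreserving_swap (μ := Measure.pi fun _ : Fin n => μ) (ν := μ))
  convert h using 1
  ext p : 1
  simp [MeasurableEquiv.piFinSuccAbove, Fin.insertNthEquiv]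

/-- Hoeffding's lemma for a random variable whose oscillation is almost surely at most `c`. -/
theorem integral_exp_le_of_ae_oscillation {Ω : Type*} [MeasurableSpace Ω] (μ : Measure Ω)
    [IsProbabilityMeasure μ] {u : Ω → ℝ} {B : ℝ} (c : ℝ≥0) (hu : Measurable u)
    (hB : ∀ y, |u y| ≤ B) (hosc : ∀ᵐ y ∂μ, ∀ᵐ z ∂μ, u y ≤ c + u z) (t : ℝ) :
    ∫ y, Real.exp (t * u y) ∂μ ≤ Real.exp (t * ∫ y, u y ∂μ + (c / 2) ^ 2 * t ^ 2 / 2) := by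
  have hbb : Filter.IsBoundedUnder (· ≥ ·) (ae μ) u :=
    ⟨-B, by simpa using Filter.Eventually.of_forall fun y => (abs_le.1 (hB y)).1⟩
  have hab : Filter.IsBoundedUnder (· ≤ ·) (ae μ) u :=
    ⟨B, by simpa using Filter.Eventually.of_forall fun y => (abs_le.1 (hB y)).2⟩
  have hmem : ∀ᵐ y ∂μ, u y ∈ Set.Icc (essInf u μ) (essInf u μ + c) := by
    filter_upwards [ae_essInf_le hbb, hosc] with y h1 h2
    refine ⟨h1, ?_⟩
    have : u y - c ≤ essInf u μ := le_essInf_of_ae_le _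
      (h2.mono fun z hz => by simpa [add_comm] using hz) hab.isCoboundedUnder_ge
    linarith
  have h := (hasSubgaussianMGF_of_mem_Icc hu.aemeasurable hmem).mgf_le t
  have hc : ‖essInf u μ + c - essInf u μ‖₊ = c := by
    rw [add_sub_cancel_left]; ext; simp
  rw [hc, mgf] at h
  have hfac : ∀ y, Real.exp (t * u y)
      = Real.exp (t * ∫ y, u y ∂μ) * Real.exp (t * (u y - ∫ x, u x ∂μ)) := fun y => by
    rw [← Real.exp_add]; ring_nf
  simp_rw [hfac]
  rw [integral_const_mul, Real.exp_add]
  gcongr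
  simpa using h

/-- The moment generating function bound behind McDiarmid's inequality, under the almost sure form
of the bounded differences property. -/
theorem integral_exp_le_of_ae_boundedDifferences {Ω : Type*} [MeasurableSpace Ω] (μ : Measure Ω)
    [IsProbabilityMeasure μ] (c : ℝ≥0) (B : ℝ) (n : ℕ) (g : (Fin n → Ω) → ℝ) (hg : Measurable g)
    (hB : ∀ x, |g x| ≤ B)
    (hosc : ∀ i y, ∀ᵐ x ∂(Measure.pi fun _ : Fin n => μ), g x ≤ c + g (Function.update x i y))
    (t : ℝ) :
    ∫ x, Real.exp (t * g x) ∂(Measure.pi fun _ : Fin n => μ)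
      ≤ Real.exp (t * ∫ x, g x ∂(Measure.pi fun _ : Fin n => μ) + n * (c / 2) ^ 2 * t ^ 2 / 2) := by
  induction n with
  | zero =>
    have : ∀ x : Fin 0 → Ω, g x = g default := fun x => congrArg g (Subsingleton.elim _ _)
    simp_rw [this]
    simp
  | succ n ih =>
    set P := Measure.pi fun _ : Fin n => μ
    have hcons := measurePreserving_cons μ n
    set G : (Fin n → Ω) × Ω → ℝ := fun p => g (Fin.cons p.2 p.1) with hGdef
    have hGm : Measurable G := hg.comp hcons.measurable
    have hGB : ∀ p, |G p| ≤ B := fun p => hB _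
    have hGi : Integrable G (P.prod μ) := integrable_of_abs_le hGm hGB
    have hsec : ∀ x, Integrable (fun y => G (x, y)) μ := fun x =>
      integrable_of_abs_le (hGm.comp measurable_prodMk_left) fun y => hGB _
    have hexpB : ∀ p, |Real.exp (t * G p)| ≤ Real.exp (|t| * B) := fun p => by
      rw [Real.abs_exp]
      refine Real.exp_le_exp.2 ((le_abs_self _).trans ?_)
      rw [abs_mul]
      exact mul_le_mul_of_nonneg_left (hGB p) (abs_nonneg t)
    have hexpm : Measurable fun p => Real.exp (t * G p) := (hGm.const_mul t).exp
    have hexpi : Integrable (fun p => Real.exp (t * G p)) (P.prod μ) :=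
      integrable_of_abs_le hexpm hexpB
    have e1 : ∫ x, Real.exp (t * g x) ∂(Measure.pi fun _ : Fin (n + 1) => μ)
        = ∫ x, ∫ y, Real.exp (t * G (x, y)) ∂μ ∂P := by
      rw [← integral_prod _ hexpi, ← hcons.map_eq,
        integral_map hcons.measurable.aemeasurable
          ((hg.const_mul t).exp.aestronglyMeasurable)]
    have e2 : ∫ x, g x ∂(Measure.pi fun _ : Fin (n + 1) => μ) = ∫ x, ∫ y, G (x, y) ∂μ ∂P := by
      rw [← integral_prod _ hGi, ← hcons.map_eq,
        integral_map hcons.measurable.aemeasurable hg.aestronglyMeasurable]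
    -- Averaging over the first coordinate keeps the bounded differences in the others.
    set m : (Fin n → Ω) → ℝ := fun x => ∫ y, G (x, y) ∂μ with hmdef
    have hmm : Measurable m := hGm.stronglyMeasurable.integral_prod_right'.measurable
    have hmB : ∀ x, |m x| ≤ B := fun x => by
      have := norm_integral_le_of_norm_le_const (μ := μ) 
        (.of_forall fun y => (Real.norm_eq_abs _).trans_le (hGB (x, y)))
      simpa using this
    have hmosc : ∀ i y, ∀ᵐ x ∂P, m x ≤ c + m (Function.update x i y) := by
      intro i z
      have h := Measure.ae_ae_of_ae_prod (hcons.quasiMeasurePreserving.ae (hosc i.succ z))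
      filter_upwards [h] with x hx
      have : ∫ y, G (x, y) ∂μ ≤ ∫ y, (c + G (Function.update x i z, y)) ∂μ := by
        refine integral_mono_ae (hsec x) ((integrable_const _).add (hsec _)) ?_
        filter_upwards [hx] with y hy
        simpa [hGdef, Fin.cons_update] using hy
      rw [integral_add (integrable_const _) (hsec _)] at this
      simpa using this
    have hosc0 : ∀ᵐ x ∂P, ∀ᵐ y ∂μ, ∀ᵐ z ∂μ, G (x, y) ≤ c + G (x, z) := by
      have h : ∀ᵐ z ∂μ, ∀ᵐ p ∂(P.prod μ), G p ≤ c + G (p.1, z) := .of_forall fun z => by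
        filter_upwards [hcons.quasiMeasurePreserving.ae (hosc 0 z)] with p hp
        simpa [hGdef] using hp
      rw [Measure.ae_ae_comm] at h
      · exact Measure.ae_ae_of_ae_prod h
      · exact measurableSet_le (by fun_prop) (by fun_prop)
    have hstep : ∀ᵐ x ∂P, ∫ y, Real.exp (t * G (x, y)) ∂μ
        ≤ Real.exp (t * m x + (c / 2) ^ 2 * t ^ 2 / 2) := by
      filter_upwards [hosc0] with x hx
      exact integral_exp_le_of_ae_oscillation μ c (hGm.comp measurable_prodMk_left)
        (fun y => hGB (x, y)) hx t
    have hmi : Integrable (fun x => Real.exp (t * m x)) P := by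
      refine integrable_of_abs_le (B := Real.exp (|t| * B)) (hmm.const_mul t).exp fun x => ?_
      rw [Real.abs_exp]
      refine Real.exp_le_exp.2 ((le_abs_self _).trans ?_)
      rw [abs_mul]
      exact mul_le_mul_of_nonneg_left (hmB x) (abs_nonneg t)
    rw [e1, e2]
    calc ∫ x, ∫ y, Real.exp (t * G (x, y)) ∂μ ∂P
        ≤ ∫ x, Real.exp ((c / 2) ^ 2 * t ^ 2 / 2) * Real.exp (t * m x) ∂P := by
          refine integral_mono_ae hexpi.integral_prod_left (hmi.const_mul _) ?_
          filter_upwards [hstep] with x hx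
          rwa [← Real.exp_add, add_comm]
      _ = Real.exp ((c / 2) ^ 2 * t ^ 2 / 2) * ∫ x, Real.exp (t * m x) ∂P :=
          integral_const_mul _ _
      _ ≤ Real.exp ((c / 2) ^ 2 * t ^ 2 / 2) *
            Real.exp (t * ∫ x, m x ∂P + n * (c / 2) ^ 2 * t ^ 2 / 2) := by
          gcongr
          exact ih m hmm hmB hmosc
      _ = _ := by
          rw [← Real.exp_add]
          congr 1
          push_cast
          ring

/-- **McDiarmid's inequality** for a function with almost surely bounded differences. -/
theorem measure_ge_le_of_ae_boundedDifferences {Ω : Type*} [MeasurableSpace Ω] (μ : Measure Ω)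
    [IsProbabilityMeasure μ] (c : ℝ≥0) {B : ℝ} {n : ℕ} {g : (Fin n → Ω) → ℝ} (hg : Measurable g)
    (hB : ∀ x, |g x| ≤ B)
    (hosc : ∀ i y, ∀ᵐ x ∂(Measure.pi fun _ : Fin n => μ), g x ≤ c + g (Function.update x i y))
    {ε : ℝ} (hε : 0 ≤ ε) :
    (Measure.pi fun _ : Fin n => μ).real
        {x | ε ≤ g x - ∫ y, g y ∂(Measure.pi fun _ : Fin n => μ)}
      ≤ Real.exp (-(2 * ε ^ 2) / (n * c ^ 2)) := by
  set P := Measure.pi fun _ : Fin n => μ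
  set M := ∫ y, g y ∂P
  have hsub : HasSubgaussianMGF (fun x => g x - M) (n * (c / 2) ^ 2) P := by
    refine ⟨fun t => ?_, fun t => ?_⟩
    · refine integrable_of_abs_le (B := Real.exp (|t| * (B + |M|)))
        ((hg.sub_const M).const_mul t).exp fun x => ?_
      rw [Real.abs_exp]
      refine Real.exp_le_exp.2 ((le_abs_self _).trans ?_)
      rw [abs_mul]
      exact mul_le_mul_of_nonneg_left ((abs_sub _ _).trans (by gcongr; exact hB x)) (abs_nonneg t)
    · have h := integral_exp_le_of_ae_boundedDifferences μ c B n g hg hB hosc t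
      have hfac : ∀ x, Real.exp (t * (g x - M)) = Real.exp (-(t * M)) * Real.exp (t * g x) :=
        fun x => by rw [← Real.exp_add]; ring_nf
      rw [mgf]
      simp_rw [hfac]
      rw [integral_const_mul]
      calc _ ≤ Real.exp (-(t * M)) * Real.exp (t * M + n * (c / 2) ^ 2 * t ^ 2 / 2) := by gcongr
        _ = _ := by
          rw [← Real.exp_add]
          congr 1
          push_cast
          ring
  refine (hsub.measure_ge_le hε).trans (le_of_eq ?_)
  congr 1
  push_cast
  rw [show (2 : ℝ) * (n * (c / 2) ^ 2) = n * c ^ 2 / 2 by ring, div_div_eq_mul_div]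
  ring

/-! ### The contraction principle -/

theorem ciSup_add_ciSup_sub_le {ι : Type*} [Nonempty ι] {a u w : ι → ℝ}
    (huw : ∀ i j, |u i - u j| ≤ |w i - w j|)
    (hadd : BddAbove (Set.range fun i => a i + w i))
    (hsub : BddAbove (Set.range fun i => a i - w i)) :
    (⨆ i, (a i + u i)) + ⨆ i, (a i - u i) ≤ (⨆ i, (a i + w i)) + ⨆ i, (a i - w i) := by
  refine ciSup_add_ciSup_le fun i j => ?_
  have h1 := le_ciSup hadd i
  have h2 := le_ciSup hsub j
  have h3 := le_ciSup hadd j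
  have h4 := le_ciSup hsub i
  have h := (le_abs_self _).trans (huw i j)
  rcases abs_cases (w i - w j) with ⟨h5, -⟩ | ⟨h5, -⟩ <;> rw [h5] at h <;> linarith

theorem sum_le_sum_of_add_flip_le {n : ℕ} (j : Fin n) {f g : (Fin n → ℤˣ) → ℝ}
    (h : ∀ σ, f σ + f (Function.update σ j (-σ j)) ≤ g σ + g (Function.update σ j (-σ j))) :
    ∑ σ, f σ ≤ ∑ σ, g σ := by
  have hinv : Function.Involutive fun σ : Fin n → ℤˣ => Function.update σ j (-σ j) := fun σ => by
    simp
  have key : ∀ f : (Fin n → ℤˣ) → ℝ, ∑ σ, f (Function.update σ j (-σ j)) = ∑ σ, f σ := fun f =>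
    Equiv.sum_comp hinv.toPerm f
  have := Finset.sum_le_sum fun σ (_ : σ ∈ Finset.univ) => h σ
  rw [Finset.sum_add_distrib, Finset.sum_add_distrib, key, key] at this
  linarith

theorem abs_signed_sum_le {n : ℕ} (σ : Fin n → ℤˣ) {v : Fin n → ℝ} {B : ℝ}
    (hv : ∀ k, |v k| ≤ B) : |∑ k, ((σ k : ℤ) : ℝ) * v k| ≤ n * B := by
  refine (Finset.abs_sum_le_sum_abs _ _).trans ?_
  have : ∀ k ∈ Finset.univ, |((σ k : ℤ) : ℝ) * v k| ≤ B := fun k _ => by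
    rcases Int.units_eq_one_or (σ k) with h | h <;> simpa [h] using hv k
  simpa using Finset.sum_le_sum this

theorem bddAbove_range_signed_sum {ι : Type*} {n : ℕ} (σ : Fin n → ℤˣ) {v : ι → Fin n → ℝ} {B : ℝ}
    (hv : ∀ i k, |v i k| ≤ B) : BddAbove (Set.range fun i => ∑ k, ((σ k : ℤ) : ℝ) * v i k) :=
  ⟨n * B, by rintro _ ⟨i, rfl⟩; exact (le_abs_self _).trans (abs_signed_sum_le σ (hv i))⟩

/-- The contraction principle for Rademacher averages, in comparison form: the average over all
signs of a supremum does not decrease when each coordinate is replaced by one that separates the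
indices at least as much. The coordinates are exchanged one after the other, pairing each sign
vector with the one that differs from it there. -/
theorem sum_iSup_signed_sum_le {ι : Type*} [Nonempty ι] {n : ℕ} {v w : ι → Fin n → ℝ} {B : ℝ}
    (hv : ∀ i k, |v i k| ≤ B) (hw : ∀ i k, |w i k| ≤ B)
    (hvw : ∀ i j k, |v i k - v j k| ≤ |w i k - w j k|) :
    ∑ σ : Fin n → ℤˣ, ⨆ i, ∑ k, ((σ k : ℤ) : ℝ) * v i k
      ≤ ∑ σ : Fin n → ℤˣ, ⨆ i, ∑ k, ((σ k : ℤ) : ℝ) * w i k := by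
  classical
  let z : Finset (Fin n) → ι → Fin n → ℝ := fun s i k => if k ∈ s then v i k else w i k
  have hz : ∀ s i k, |z s i k| ≤ B := fun s i k => by
    by_cases h : k ∈ s
    · simpa [z, h] using hv i k
    · simpa [z, h] using hw i k
  suffices H : ∀ s : Finset (Fin n), ∑ σ : Fin n → ℤˣ, ⨆ i, ∑ k, ((σ k : ℤ) : ℝ) * z s i k
      ≤ ∑ σ : Fin n → ℤˣ, ⨆ i, ∑ k, ((σ k : ℤ) : ℝ) * w i k by
    simpa [z] using H Finset.univ
  intro s
  induction s using Finset.induction_on with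
  | empty => simp [z]
  | insert j s hj ih =>
    refine le_trans (sum_le_sum_of_add_flip_le j fun σ => ?_) ih
    -- The signed sum splits into the part away from `j`, which the flip keeps, and the `j`-th term.
    let a : ι → ℝ := fun i => ∑ k ∈ Finset.univ.erase j, ((σ k : ℤ) : ℝ) * z s i k
    have split : ∀ (τ : Fin n → ℤˣ) (y : ι → Fin n → ℝ), (∀ k ≠ j, τ k = σ k) →
        (∀ i, ∀ k ≠ j, y i k = z s i k) → ∀ i, ∑ k, ((τ k : ℤ) : ℝ) * y i k
          = a i + ((τ j : ℤ) : ℝ) * y i j := by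
      intro τ y hτ hy i
      rw [← Finset.sum_erase_add _ _ (Finset.mem_univ j)]
      congr 1
      refine Finset.sum_congr rfl fun k hk => ?_
      rw [hτ k (Finset.ne_of_mem_erase hk), hy i k (Finset.ne_of_mem_erase hk)]
    have hflip : ∀ k ≠ j, Function.update σ j (-σ j) k = σ k := fun k hk =>
      Function.update_of_ne hk _ _
    have hins : ∀ i, ∀ k ≠ j, z (insert j s) i k = z s i k := fun i k hk => by simp [z, hk]
    have s1 := split σ (z (insert j s)) (fun _ _ => rfl) hins
    have s2 := split _ (z (insert j s)) hflip hins
    have s3 := split σ (z s) (fun _ _ => rfl) (fun _ _ _ => rfl)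
    have s4 := split _ (z s) hflip (fun _ _ _ => rfl)
    have b3 := bddAbove_range_signed_sum σ (hz s)
    have b4 := bddAbove_range_signed_sum (Function.update σ j (-σ j)) (hz s)
    simp only [s3] at b3
    simp only [s4] at b4
    simp only [s1, s2, s3, s4]
    simp only [Function.update_self, Units.val_neg, Int.cast_neg, neg_mul, ← sub_eq_add_neg]
      at b4 ⊢
    refine ciSup_add_ciSup_sub_le (fun i i' => ?_) b3 b4
    have hj1 : ∀ i, z (insert j s) i j = v i j := fun i => by simp [z]
    have hj2 : ∀ i, z s i j = w i j := fun i => by simp [z, hj]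
    rw [← mul_sub, ← mul_sub, abs_mul, abs_mul, hj1, hj1, hj2, hj2]
    exact mul_le_mul_of_nonneg_left (hvw i i' j) (abs_nonneg _)

/-- The contraction principle survives the passage to measurable majorants: the signed suprema of
the class `φ ∘ f` need not be measurable, but they are dominated by measurable functions whose sum
over all signs is controlled by given measurable majorants `V` for the class itself.

The sample space is cut into the countably many pieces on which all `V σ` are constant up to a
small error. The contraction principle is then applied to all pairs of a function and a
sample in the same piece at once, which is possible because `φ` does not depend on the sample. -/
theorem exists_measurable_majorant_contraction {X ι : Type*} [MeasurableSpace X] [Nonempty ι]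
    {n : ℕ} {f : ι → X → ℝ} {C B : ℝ} (hf : ∀ i x, |f i x| ≤ C) {φ : ℝ → ℝ} {L : ℝ≥0}
    (hφ : LipschitzWith L φ) (hφB : ∀ i x, |φ (f i x)| ≤ B)
    {V : (Fin n → ℤˣ) → (Fin n → X) → ℝ} (hV : ∀ σ, Measurable (V σ))
    (hfV : ∀ σ i x, ∑ k, ((σ k : ℤ) : ℝ) * f i (x k) ≤ V σ x) {η : ℝ} (hη : 0 < η) :
    ∃ U : (Fin n → ℤˣ) → (Fin n → X) → ℝ, (∀ σ, Measurable (U σ)) ∧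
      (∀ σ i x, ∑ k, ((σ k : ℤ) : ℝ) * φ (f i (x k)) ≤ U σ x) ∧ (∀ σ x, |U σ x| ≤ n * B) ∧
      ∀ x, ∑ σ, U σ x ≤ L * ∑ σ, V σ x + η := by
  obtain ⟨θ, hθ, hθη⟩ : ∃ θ : ℝ, 0 < θ ∧ L * ∑ _σ : Fin n → ℤˣ, θ ≤ η := by
    refine ⟨η / ((L + 1) * Fintype.card (Fin n → ℤˣ)), by positivity, ?_⟩
    have : (0 : ℝ) < Fintype.card (Fin n → ℤˣ) := by positivity
    have hL : (0 : ℝ) ≤ L := L.2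
    rw [Finset.sum_const, nsmul_eq_mul, Finset.card_univ]
    rw [← mul_assoc, mul_div_assoc', div_le_iff₀ (by positivity)]
    nlinarith [mul_pos this hη]
  let key : (Fin n → X) → (Fin n → ℤˣ) → ℤ := fun x σ => ⌊V σ x / θ⌋
  have hkey : Measurable key :=
    measurable_pi_iff.2 fun σ => Int.measurable_floor.comp ((hV σ).div_const θ)
  have hVkey : ∀ x y, key y = key x → ∀ σ, V σ y ≤ V σ x + θ := by
    intro x y h σ
    have h1 := (abs_lt.1 (Int.abs_sub_lt_one_of_floor_eq_floor (congrFun h σ))).2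
    rw [← sub_div, div_lt_one hθ] at h1
    linarith
  let s : (Fin n → ℤˣ) → ((Fin n → ℤˣ) → ℤ) → ℝ := fun σ κ =>
    ⨆ p : ι × {y // key y = κ}, ∑ k, ((σ k : ℤ) : ℝ) * φ (f p.1 (p.2.1 k))
  have hb : ∀ (σ : Fin n → ℤˣ) (κ : (Fin n → ℤˣ) → ℤ),
      BddAbove (Set.range fun p : ι × {y // key y = κ} =>
      ∑ k, ((σ k : ℤ) : ℝ) * φ (f p.1 (p.2.1 k))) := fun σ κ =>
    bddAbove_range_signed_sum σ (v := fun (p : ι × {y // key y = κ}) k => φ (f p.1 (p.2.1 k)))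
      fun p k => hφB _ _
  have hle : ∀ (σ : Fin n → ℤˣ) i x, ∑ k, ((σ k : ℤ) : ℝ) * φ (f i (x k)) ≤ s σ (key x) :=
    fun σ i x =>
    le_ciSup (hb σ (key x)) (i, ⟨x, rfl⟩)
  refine ⟨fun σ x => s σ (key x), fun σ => (measurable_of_countable (s σ)).comp hkey, hle,
    fun σ x => abs_le.2 ⟨?_, ?_⟩, fun x => ?_⟩
  · obtain ⟨i⟩ := ‹Nonempty ι›
    exact (abs_le.1 (abs_signed_sum_le σ fun k => hφB i (x k))).1.trans (hle σ i x)
  · have : Nonempty {y // key y = key x} := ⟨⟨x, rfl⟩⟩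
    exact ciSup_le fun p => (le_abs_self _).trans (abs_signed_sum_le σ fun k => hφB _ _)
  · have : Nonempty {y // key y = key x} := ⟨⟨x, rfl⟩⟩
    calc ∑ σ, s σ (key x)
        ≤ ∑ σ : Fin n → ℤˣ, ⨆ p : ι × {y // key y = key x},
            ∑ k, ((σ k : ℤ) : ℝ) * (L * f p.1 (p.2.1 k)) := by
          refine sum_iSup_signed_sum_le
            (v := fun (p : ι × {y // key y = key x}) k => φ (f p.1 (p.2.1 k)))
            (w := fun (p : ι × {y // key y = key x}) k => L * f p.1 (p.2.1 k))
            (B := max B (L * C)) (fun p k => (hφB _ _).trans (le_max_left _ _))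
            (fun p k => le_trans ?_ (le_max_right _ _)) fun p q k => ?_
          · rw [abs_mul, NNReal.abs_eq]
            exact mul_le_mul_of_nonneg_left (hf _ _) L.2
          · rw [← mul_sub, abs_mul, NNReal.abs_eq]
            exact hφ.dist_le_mul _ _
      _ ≤ ∑ σ : Fin n → ℤˣ, L * (V σ x + θ) := by
          refine Finset.sum_le_sum fun σ _ => ciSup_le fun p => ?_
          have : ∑ k, ((σ k : ℤ) : ℝ) * (L * f p.1 (p.2.1 k))
              = L * ∑ k, ((σ k : ℤ) : ℝ) * f p.1 (p.2.1 k) := by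
            rw [Finset.mul_sum]
            exact Finset.sum_congr rfl fun k _ => by ring
          rw [this]
          exact mul_le_mul_of_nonneg_left ((hfV σ _ _).trans (hVkey x _ p.2.2 σ)) L.2
      _ = L * ∑ σ, V σ x + L * ∑ _σ : Fin n → ℤˣ, θ := by
          rw [← Finset.mul_sum, Finset.sum_add_distrib, mul_add]
      _ ≤ _ := by gcongr

/-! ### Rademacher complexity -/

theorem abs_signedSup_le {X : Type*} {F : Set (X → ℝ)} (hF : F.Nonempty) {C : ℝ}
    (hC : ∀ f ∈ F, ∀ x, |f x| ≤ C) {n : ℕ} (σ : Fin n → ℤˣ) (x : Fin n → X) :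
    BddAbove (Set.range fun f : F => (1 / (n : ℝ)) * ∑ k, ((σ k : ℤ) : ℝ) * f.1 (x k)) ∧
      |signedSup F σ x| ≤ 1 / n * (n * C) := by
  have h : ∀ f : F, |(1 / (n : ℝ)) * ∑ k, ((σ k : ℤ) : ℝ) * f.1 (x k)| ≤ 1 / n * (n * C) :=
    fun f => by
      rw [abs_mul, abs_of_nonneg (by positivity : (0 : ℝ) ≤ 1 / n)]
      exact mul_le_mul_of_nonneg_left (abs_signed_sum_le σ fun k => hC f.1 f.2 (x k))
        (by positivity)
  have hb : BddAbove (Set.range fun f : F => (1 / (n : ℝ)) * ∑ k, ((σ k : ℤ) : ℝ) * f.1 (x k)) :=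
    ⟨1 / n * (n * C), by rintro _ ⟨f, rfl⟩; exact (abs_le.1 (h f)).2⟩
  have : Nonempty F := hF.to_subtype
  refine ⟨hb, abs_le.2 ⟨?_, ciSup_le fun f => (abs_le.1 (h f)).2⟩⟩
  obtain ⟨f⟩ := this
  exact (abs_le.1 (h f)).1.trans (le_ciSup hb f)

theorem integrable_signedSup {X : Type*} [MeasurableSpace X] {μ : Measure X}
    [IsProbabilityMeasure μ] {n : ℕ} {F : Set (X → ℝ)} (hF : F.Nonempty) {C : ℝ}
    (hC : ∀ f ∈ F, ∀ x, |f x| ≤ C) (hm : RademacherMeasurable μ n F) (σ : Fin n → ℤˣ) :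
    Integrable (signedSup F σ) (Measure.pi fun _ : Fin n => μ) :=
  .of_bound (hm σ).aestronglyMeasurable _ (.of_forall fun x => (abs_signedSup_le hF hC σ x).2)

theorem rademacher_nonneg {X : Type*} [MeasurableSpace X] {μ : Measure X}
    [IsProbabilityMeasure μ] {n : ℕ} {F : Set (X → ℝ)} (hF : F.Nonempty) {C : ℝ}
    (hC : ∀ f ∈ F, ∀ x, |f x| ≤ C) (hm : RademacherMeasurable μ n F) : 0 ≤ rademacher μ n F := by
  rw [rademacher, ← integral_finsetSum _ fun σ _ => integrable_signedSup hF hC hm σ]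
  refine mul_nonneg (by positivity) (integral_nonneg fun x => ?_)
  obtain ⟨f, hf⟩ := hF
  -- A single function bounds the suprema below, and its signed sums cancel under `σ ↦ -σ`.
  have h : ∑ σ : Fin n → ℤˣ, (1 / (n : ℝ)) * ∑ k, ((σ k : ℤ) : ℝ) * f (x k) = 0 := by
    have e := Equiv.sum_comp (Equiv.neg (Fin n → ℤˣ))
      fun σ => (1 / (n : ℝ)) * ∑ k, ((σ k : ℤ) : ℝ) * f (x k)
    simp only [Equiv.neg_apply, Pi.neg_apply, Units.val_neg, Int.cast_neg, neg_mul,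
      Finset.sum_neg_distrib, mul_neg] at e
    linarith
  show 0 ≤ ∑ σ, signedSup F σ x
  rw [← h]
  exact Finset.sum_le_sum fun σ _ =>
    le_ciSup (abs_signedSup_le ⟨f, hf⟩ hC σ x).1 ⟨f, hf⟩

/-- An almost everywhere measurable bounded function has a measurable majorant that agrees with it
almost everywhere. -/
theorem exists_measurable_majorant_ae_eq {α : Type*} [MeasurableSpace α] {μ : Measure α}
    {g : α → ℝ} {B : ℝ} (hg : AEMeasurable g μ) (hB : ∀ x, g x ≤ B) :
    ∃ V : α → ℝ, Measurable V ∧ (∀ x, g x ≤ V x) ∧ V =ᵐ[μ] g := by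
  classical
  set N := toMeasurable μ {x | ¬ g x = hg.mk g x} with hN
  have hN0 : μ N = 0 := by rw [hN, measure_toMeasurable]; exact hg.ae_eq_mk
  have hsub : ∀ x ∉ N, g x = hg.mk g x := fun x hx => by
    by_contra h
    exact hx (subset_toMeasurable μ _ h)
  refine ⟨fun x => if x ∈ N then B else hg.mk g x,
    Measurable.ite (measurableSet_toMeasurable _ _) measurable_const hg.measurable_mk,
    fun x => ?_, ?_⟩
  · by_cases h : x ∈ N
    · simpa [h] using hB x
    · simp [h, ← hsub x h]
  · filter_upwards [measure_eq_zero_iff_ae_notMem.1 hN0] with x hx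
    simp [hx, ← hsub x hx]

/-- Measurable majorants of the signed suprema of `φ ∘ f`, `f ∈ F`, whose average is at most
`L` times the Rademacher complexity of `F`, up to `η`. -/
theorem exists_measurable_majorant_rademacher {X : Type*} [MeasurableSpace X] {μ : Measure X}
    [IsProbabilityMeasure μ] {n : ℕ} (hn : 1 ≤ n) {F : Set (X → ℝ)} (hF : F.Nonempty) {C B : ℝ}
    (hC : ∀ f ∈ F, ∀ x, |f x| ≤ C) (hm : RademacherMeasurable μ n F) {φ : ℝ → ℝ} {L : ℝ≥0}
    (hφ : LipschitzWith L φ) (hφB : ∀ f ∈ F, ∀ x, |φ (f x)| ≤ B) {η : ℝ} (hη : 0 < η) :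
    ∃ U : (Fin n → ℤˣ) → (Fin n → X) → ℝ, (∀ σ, Measurable (U σ)) ∧
      (∀ σ, ∀ f ∈ F, ∀ x, (1 / (n : ℝ)) * ∑ k, ((σ k : ℤ) : ℝ) * φ (f (x k)) ≤ U σ x) ∧
      (∀ σ x, |U σ x| ≤ B) ∧
      (1 / (2 : ℝ) ^ n) * ∑ σ, ∫ x, U σ x ∂(Measure.pi fun _ : Fin n => μ)
        ≤ L * rademacher μ n F + η := by
  have hn0 : (0 : ℝ) < n := by exact_mod_cast hn
  set P := Measure.pi fun _ : Fin n => μ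
  have : Nonempty F := hF.to_subtype
  have hV := fun σ => exists_measurable_majorant_ae_eq (hm σ)
    fun x => (abs_le.1 (abs_signedSup_le hF hC σ x).2).2
  choose V hVm hVge hVae using hV
  obtain ⟨U, hUm, hUge, hUB, hUV⟩ := exists_measurable_majorant_contraction (n := n)
    (f := fun (f : F) => f.1) (fun f x => hC f.1 f.2 x) hφ (fun f x => hφB f.1 f.2 x)
    (V := fun σ x => n * V σ x) (fun σ => (hVm σ).const_mul _) (fun σ f x => by
      have h := (le_ciSup (abs_signedSup_le hF hC σ x).1 f).trans (hVge σ x)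
      rwa [one_div, inv_mul_le_iff₀ hn0] at h) (η := n * η) (by positivity)
  have hUi : ∀ σ, Integrable (U σ) P := fun σ => integrable_of_abs_le (hUm σ) (hUB σ)
  have hVi : ∀ σ, Integrable (V σ) P := fun σ =>
    (integrable_signedSup hF hC hm σ).congr (hVae σ).symm
  refine ⟨fun σ x => 1 / n * U σ x, fun σ => (hUm σ).const_mul _, fun σ f hf x => ?_,
    fun σ x => ?_, ?_⟩
  · exact mul_le_mul_of_nonneg_left (hUge σ ⟨f, hf⟩ x) (by positivity)
  · rw [abs_mul, abs_of_nonneg (by positivity : (0 : ℝ) ≤ 1 / n), one_div, inv_mul_le_iff₀ hn0]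
    exact hUB σ x
  · have h1 : ∑ σ, ∫ x, 1 / (n : ℝ) * U σ x ∂P = ∫ x, 1 / (n : ℝ) * ∑ σ, U σ x ∂P := by
      simp_rw [integral_const_mul]
      rw [← Finset.mul_sum, integral_finsetSum _ fun σ _ => hUi σ]
    have h2 : rademacher μ n F = (1 / (2 : ℝ) ^ n) * ∫ x, ∑ σ, V σ x ∂P := by
      rw [rademacher, integral_finsetSum _ fun σ _ => hVi σ]
      congr 1
      exact Finset.sum_congr rfl fun σ _ => integral_congr_ae (hVae σ).symm
    have h3 : ∫ x, 1 / (n : ℝ) * ∑ σ, U σ x ∂P ≤ ∫ x, (L * ∑ σ, V σ x + η) ∂P := by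
      refine integral_mono ((integrable_finsetSum _ fun σ _ => hUi σ).const_mul _)
        (((integrable_finsetSum _ fun σ _ => hVi σ).const_mul _).add (integrable_const _))
        fun x => ?_
      have := hUV x
      rw [← Finset.mul_sum] at this
      show 1 / (n : ℝ) * ∑ σ, U σ x ≤ _
      rw [one_div, inv_mul_le_iff₀ hn0]
      linarith
    rw [integral_add ((integrable_finsetSum _ fun σ _ => hVi σ).const_mul _)
      (integrable_const _), integral_const_mul, integral_const_mul] at h3
    simp only [integral_const, probReal_univ, one_smul] at h3
    have h4 : (1 / (2 : ℝ) ^ n) ≤ 1 := by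
      rw [one_div]
      exact inv_le_one_of_one_le₀ (one_le_pow₀ (by norm_num))
    have h5 : (0 : ℝ) < 1 / (2 : ℝ) ^ n := by positivity
    rw [h1, h2, integral_const_mul]
    have h6 := mul_le_mul_of_nonneg_left h3 h5.le
    have h7 := mul_le_mul_of_nonneg_right h4 hη.le
    linarith

/-! ### Symmetrization and uniform deviations -/

theorem integral_empirical_mean {Ω : Type*} [MeasurableSpace Ω] {μ : Measure Ω}
    [IsProbabilityMeasure μ] {n : ℕ} (hn : 1 ≤ n) {h : Ω → ℝ} {B : ℝ} (hm : Measurable h)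
    (hB : ∀ x, |h x| ≤ B) :
    ∫ S, (1 / (n : ℝ)) * ∑ k, h (S k) ∂(Measure.pi fun _ : Fin n => μ) = ∫ x, h x ∂μ := by
  have hn0 : (n : ℝ) ≠ 0 := by positivity
  have hk : ∀ k : Fin n, ∫ S, h (S k) ∂(Measure.pi fun _ : Fin n => μ) = ∫ x, h x ∂μ := fun k => by
    have hp := measurePreserving_eval (fun _ : Fin n => μ) k
    refine (integral_map hp.measurable.aemeasurable hm.aestronglyMeasurable).symm.trans ?_
    rw [hp.map_eq]
  have hki : ∀ k : Fin n, Integrable (fun S => h (S k)) (Measure.pi fun _ : Fin n => μ) :=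
    fun k => integrable_of_abs_le (hm.comp (measurable_pi_apply k)) fun S => hB (S k)
  rw [integral_const_mul, integral_finsetSum _ fun k _ => hki k]
  simp only [hk, Finset.sum_const, Finset.card_univ, Fintype.card_fin, nsmul_eq_mul]
  field_simp

theorem measurable_empirical_mean {Ω : Type*} [MeasurableSpace Ω] (n : ℕ) {h : Ω → ℝ}
    (hm : Measurable h) : Measurable fun S : Fin n → Ω => (1 / (n : ℝ)) * ∑ k, h (S k) :=
  (Finset.measurable_sum _ fun k _ => hm.comp (measurable_pi_apply k)).const_mul _

theorem abs_empirical_mean_le {Ω : Type*} {n : ℕ} (hn : 1 ≤ n) {h : Ω → ℝ} {B : ℝ}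
    (hB : ∀ x, |h x| ≤ B) (S : Fin n → Ω) : |(1 / (n : ℝ)) * ∑ k, h (S k)| ≤ B := by
  have hn0 : (0 : ℝ) < n := by exact_mod_cast hn
  rw [abs_mul, abs_of_nonneg (by positivity : (0 : ℝ) ≤ 1 / n), one_div, inv_mul_le_iff₀ hn0]
  refine (Finset.abs_sum_le_sum_abs _ _).trans ?_
  simpa using Finset.sum_le_sum fun k (_ : k ∈ Finset.univ) => hB (S k)

/-- The coordinatewise choice between two samples: coordinate `k` comes from the second sample if
`ε k = 1` and from the first one otherwise. -/
def mix {Ω : Type*} {n : ℕ} (ε : Fin n → ℤˣ) (q : (Fin n → Ω) × (Fin n → Ω)) : Fin n → Ω :=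
  fun k => if ε k = 1 then q.2 k else q.1 k

theorem measurePreserving_mix {Ω : Type*} [MeasurableSpace Ω] (μ : Measure Ω)
    [IsProbabilityMeasure μ] {n : ℕ} (ε : Fin n → ℤˣ) :
    MeasurePreserving (mix (Ω := Ω) ε)
      ((Measure.pi fun _ : Fin n => μ).prod (Measure.pi fun _ : Fin n => μ))
      (Measure.pi fun _ : Fin n => μ) := by
  have h1 := (measurePreserving_arrowProdEquivProdArrow Ω Ω (Fin n) (fun _ => μ) fun _ => μ).symm
  have h2 : MeasurePreserving
      (fun (a : Fin n → Ω × Ω) (k : Fin n) => if ε k = 1 then (a k).2 else (a k).1)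
      (Measure.pi fun _ : Fin n => μ.prod μ) (Measure.pi fun _ : Fin n => μ) := by
    refine measurePreserving_pi (fun _ => μ.prod μ) (fun _ => μ)
      (f := fun k (z : Ω × Ω) => if ε k = 1 then z.2 else z.1) fun k => ?_
    by_cases hk : ε k = 1
    · simpa [hk] using measurePreserving_snd
    · simpa [hk] using measurePreserving_fst
  exact h2.comp h1

/-- Symmetrization, with measurable majorants in place of the possibly nonmeasurable suprema: the
deviation of empirical means from the mean is dominated by a single measurable function whose
integral is twice the average of the integrals of majorants `N ε` of the signed means. -/
theorem exists_measurable_majorant_deviation {Ω ι : Type*} [MeasurableSpace Ω] {μ : Measure Ω}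
    [IsProbabilityMeasure μ] {n : ℕ} (hn : 1 ≤ n) {h : ι → Ω → ℝ} {B A : ℝ}
    (hm : ∀ i, Measurable (h i)) (hB : ∀ i x, |h i x| ≤ B)
    {N : (Fin n → ℤˣ) → (Fin n → Ω) → ℝ} (hN : ∀ ε, Measurable (N ε)) (hNA : ∀ ε S, |N ε S| ≤ A)
    (hhN : ∀ ε i S, (1 / (n : ℝ)) * ∑ k, ((ε k : ℤ) : ℝ) * h i (S k) ≤ N ε S) :
    ∃ W : (Fin n → Ω) → ℝ, Measurable W ∧ (∃ A', ∀ S, |W S| ≤ A') ∧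
      (∀ i S, ∫ x, h i x ∂μ - (1 / (n : ℝ)) * ∑ k, h i (S k) ≤ W S) ∧
      ∫ S, W S ∂(Measure.pi fun _ : Fin n => μ)
        = 2 * ((1 / (2 : ℝ) ^ n) * ∑ ε, ∫ S, N ε S ∂(Measure.pi fun _ : Fin n => μ)) := by
  set P := Measure.pi fun _ : Fin n => μ with hP
  have h2n : (0 : ℝ) < 1 / (2 : ℝ) ^ n := by positivity
  -- `K ε q` dominates the difference of the means over the two samples in `q`, for every `ε`.
  let K : (Fin n → ℤˣ) → (Fin n → Ω) × (Fin n → Ω) → ℝ := fun ε q =>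
    N ε (mix ε q) + N (-ε) (mix (-ε) q)
  have hK1 : ∀ ε ε', Measurable fun q => N ε (mix ε' q) := fun ε ε' =>
    (hN ε).comp (measurePreserving_mix μ ε').measurable
  have hKm : ∀ ε, Measurable (K ε) := fun ε => (hK1 ε ε).add (hK1 (-ε) (-ε))
  have hKA : ∀ ε q, |K ε q| ≤ A + A := fun ε q =>
    (abs_add_le _ _).trans (add_le_add (hNA _ _) (hNA _ _))
  have hmixint : ∀ ε ε', ∫ q, N ε (mix ε' q) ∂(P.prod P) = ∫ S, N ε S ∂P := fun ε ε' => by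
    have hp := measurePreserving_mix μ ε'
    refine (integral_map hp.measurable.aemeasurable (hN ε).aestronglyMeasurable).symm.trans ?_
    rw [hp.map_eq]
  have hKdom : ∀ ε i S S', (1 / (n : ℝ)) * ∑ k, h i (S' k) - (1 / (n : ℝ)) * ∑ k, h i (S k)
      ≤ K ε (S, S') := by
    intro ε i S S'
    refine le_trans (le_of_eq ?_)
      (add_le_add (hhN ε i (mix ε (S, S'))) (hhN (-ε) i (mix (-ε) (S, S'))))
    rw [← mul_sub, ← mul_add, ← Finset.sum_sub_distrib, ← Finset.sum_add_distrib]
    congr 1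
    refine Finset.sum_congr rfl fun k _ => ?_
    have h11 : (-1 : ℤˣ) ≠ 1 := by decide
    rcases Int.units_eq_one_or (ε k) with e | e <;> simp [mix, e, h11] <;> ring
  let w : (Fin n → ℤˣ) → (Fin n → Ω) → ℝ := fun ε S => ∫ S', K ε (S, S') ∂P
  have hwm : ∀ ε, Measurable (w ε) := fun ε =>
    (hKm ε).stronglyMeasurable.integral_prod_right'.measurable
  have hwA : ∀ ε S, |w ε S| ≤ A + A := fun ε S => by
    have := norm_integral_le_of_norm_le_const (μ := P)
      (.of_forall fun S' => (Real.norm_eq_abs _).trans_le (hKA ε (S, S')))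
    simpa using this
  have hwdom : ∀ ε i S, ∫ x, h i x ∂μ - (1 / (n : ℝ)) * ∑ k, h i (S k) ≤ w ε S := by
    intro ε i S
    have hei : Integrable (fun S' : Fin n → Ω => (1 / (n : ℝ)) * ∑ k, h i (S' k)) P :=
      integrable_of_abs_le (measurable_empirical_mean n (hm i)) (abs_empirical_mean_le hn (hB i))
    have := integral_mono (hei.sub (integrable_const ((1 / (n : ℝ)) * ∑ k, h i (S k))))
      (integrable_of_abs_le ((hKm ε).comp measurable_prodMk_left) fun S' => hKA ε (S, S'))
      (hKdom ε i S)
    have e : ∫ S' : Fin n → Ω, (((1 / (n : ℝ)) * ∑ k, h i (S' k))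
        - (1 / (n : ℝ)) * ∑ k, h i (S k)) ∂P
        = ∫ x, h i x ∂μ - (1 / (n : ℝ)) * ∑ k, h i (S k) := by
      rw [integral_sub hei (integrable_const _), integral_empirical_mean hn (hm i) (hB i)]
      simp
    rw [← e]
    exact this
  have hwint : ∀ ε, ∫ S, w ε S ∂P = ∫ S, N ε S ∂P + ∫ S, N (-ε) S ∂P := by
    intro ε
    rw [← integral_prod _ (integrable_of_abs_le (hKm ε) (hKA ε)),
      integral_add (integrable_of_abs_le (hK1 _ _) fun q => hNA _ _)
        (integrable_of_abs_le (hK1 _ _) fun q => hNA _ _), hmixint, hmixint]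
  have hcard : (Fintype.card (Fin n → ℤˣ) : ℝ) = 2 ^ n := by simp
  have hone : ∀ r : ℝ, (1 / (2 : ℝ) ^ n) * ∑ _ε : Fin n → ℤˣ, r = r := fun r => by
    rw [Finset.sum_const, Finset.card_univ, nsmul_eq_mul, hcard]
    field_simp
  refine ⟨fun S => (1 / (2 : ℝ) ^ n) * ∑ ε, w ε S,
    (Finset.measurable_sum _ fun ε _ => hwm ε).const_mul _, ⟨A + A, fun S => ?_⟩,
    fun i S => ?_, ?_⟩
  · rw [abs_mul, abs_of_pos h2n, ← hone (A + A)]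
    exact mul_le_mul_of_nonneg_left ((Finset.abs_sum_le_sum_abs _ _).trans
      (Finset.sum_le_sum fun ε _ => hwA ε S)) h2n.le
  · rw [← hone (∫ x, h i x ∂μ - _)]
    exact mul_le_mul_of_nonneg_left (Finset.sum_le_sum fun ε _ => hwdom ε i S) h2n.le
  · rw [integral_const_mul, integral_finsetSum _ fun ε _ => integrable_of_abs_le (hwm ε) (hwA ε)]
    simp only [hwint]
    have hneg : ∑ ε, ∫ S, N (-ε) S ∂P = ∑ ε, ∫ S, N ε S ∂P :=
      Equiv.sum_comp (Equiv.neg (Fin n → ℤˣ)) fun ε => ∫ S, N ε S ∂P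
    rw [Finset.sum_add_distrib, hneg]
    ring

/-- Uniform deviation bound from measurable majorants `W` of the deviations: such a `W` need not
have bounded differences, but the least measurable majorant does, almost surely. -/
theorem exists_measurableSet_deviation_le {Ω ι : Type*} [MeasurableSpace Ω] [Nonempty ι]
    {μ : Measure Ω} [IsProbabilityMeasure μ] {n : ℕ} (hn : 1 ≤ n) {h : ι → Ω → ℝ} {B w : ℝ}
    (hB : ∀ i x, |h i x| ≤ B) {c : ℝ≥0} (hc : ∀ i x y, h i x - h i y ≤ c)
    (hW : ∀ η > 0, ∃ W : (Fin n → Ω) → ℝ, Measurable W ∧ (∃ A, ∀ S, |W S| ≤ A) ∧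
      (∀ i S, ∫ x, h i x ∂μ - (1 / (n : ℝ)) * ∑ k, h i (S k) ≤ W S) ∧
      ∫ S, W S ∂(Measure.pi fun _ : Fin n => μ) ≤ w + η) {ε : ℝ} (hε : 0 ≤ ε) :
    ∃ G : Set (Fin n → Ω), MeasurableSet G ∧
      1 - Real.exp (-(2 * n * ε ^ 2) / c ^ 2) ≤ (Measure.pi fun _ : Fin n => μ).real G ∧
      ∀ S ∈ G, ∀ i, ∫ x, h i x ∂μ - (1 / (n : ℝ)) * ∑ k, h i (S k) ≤ w + ε := by
  have hn0 : (0 : ℝ) < n := by exact_mod_cast hn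
  set P := Measure.pi fun _ : Fin n => μ
  let d : ι → (Fin n → Ω) → ℝ := fun i S => ∫ x, h i x ∂μ - (1 / (n : ℝ)) * ∑ k, h i (S k)
  have hdB : ∀ i S, |d i S| ≤ B + B := fun i S => by
    refine (abs_sub _ _).trans (add_le_add ?_ (abs_empirical_mean_le hn (hB i) S))
    have := norm_integral_le_of_norm_le_const (μ := μ)
      (.of_forall fun x => (Real.norm_eq_abs _).trans_le (hB i x))
    simpa using this
  have hbdd : ∀ S, BddAbove (Set.range fun i => d i S) := fun S =>
    ⟨B + B, by rintro _ ⟨i, rfl⟩; exact (abs_le.1 (hdB i S)).2⟩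
  let Φ : (Fin n → Ω) → ℝ := fun S => ⨆ i, d i S
  have hdΦ : ∀ i S, d i S ≤ Φ S := fun i S => le_ciSup (hbdd S) i
  have hΦB : ∀ S, |Φ S| ≤ B + B := fun S => by
    refine abs_le.2 ⟨?_, ciSup_le fun i => (abs_le.1 (hdB i S)).2⟩
    obtain ⟨i⟩ := ‹Nonempty ι›
    exact (abs_le.1 (hdB i S)).1.trans (hdΦ i S)
  obtain ⟨g, hgm, hΦg, hgB, hgmin⟩ := exists_measurable_envelope P hΦB
  have hupd : ∀ (S : Fin n → Ω) k y, Φ S ≤ (c / n : ℝ≥0) + Φ (Function.update S k y) := by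
    intro S k y
    refine ciSup_le fun i => le_trans ?_ (add_le_add_right (hdΦ i _) _)
    have e1 : ∑ j, h i (S j) = ∑ j ∈ Finset.univ.erase k, h i (S j) + h i (S k) :=
      (Finset.sum_erase_add _ _ (Finset.mem_univ k)).symm
    have e2 : ∑ j, h i (Function.update S k y j)
        = ∑ j ∈ Finset.univ.erase k, h i (S j) + h i y := by
      rw [← Finset.sum_erase_add _ _ (Finset.mem_univ k), Function.update_self]
      congr 1
      exact Finset.sum_congr rfl fun j hj => by
        rw [Function.update_of_ne (Finset.ne_of_mem_erase hj)]
    show ∫ x, h i x ∂μ - (1 / (n : ℝ)) * ∑ k, h i (S k) ≤ (c / n : ℝ≥0)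
      + (∫ x, h i x ∂μ - (1 / (n : ℝ)) * ∑ j, h i (Function.update S k y j))
    rw [e1, e2]
    have h1 := mul_le_mul_of_nonneg_left (hc i y (S k)) (one_div_pos.2 hn0).le
    have h2 : ((c / n : ℝ≥0) : ℝ) = 1 / n * c := by push_cast; ring
    rw [h2]
    linarith
  -- For fixed `k` and `y`, the right-hand side below is itself a measurable majorant.
  have hosc : ∀ k y, ∀ᵐ S ∂P, g S ≤ (c / n : ℝ≥0) + g (Function.update S k y) := fun k y =>
    hgmin _ ((hgm.comp (by fun_prop)).const_add _)
      fun S => (hupd S k y).trans (add_le_add_right (hΦg _) _)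
  have hgw : ∫ S, g S ∂P ≤ w := by
    refine le_of_forall_pos_le_add fun η hη => ?_
    obtain ⟨W, hWm, ⟨A, hWA⟩, hhW, hw⟩ := hW η hη
    refine (integral_mono_ae (integrable_of_abs_le hgm hgB) (integrable_of_abs_le hWm hWA)
      (hgmin W hWm fun S => ?_)).trans hw
    exact ciSup_le fun i => hhW i S
  have hmd := measure_ge_le_of_ae_boundedDifferences μ (c / n) hgm hgB hosc hε
  have hGm : MeasurableSet {S | ε ≤ g S - ∫ y, g y ∂P} :=
    measurableSet_le measurable_const (hgm.sub_const _)
  refine ⟨{S | ε ≤ g S - ∫ y, g y ∂P}ᶜ, hGm.compl, ?_, fun S hS i => ?_⟩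
  · rw [probReal_compl_eq_one_sub hGm]
    refine sub_le_sub_left (hmd.trans (le_of_eq ?_)) 1
    congr 1
    push_cast
    rw [show (n : ℝ) * (c / n) ^ 2 = c ^ 2 / n by field_simp, div_div_eq_mul_div]
    ring
  · have h1 : ¬ ε ≤ g S - ∫ y, g y ∂P := hS
    have h2 := (hdΦ i S).trans (hΦg S)
    show d i S ≤ _
    linarith [not_le.1 h1]

/-! ### The law of a pairwise comparison -/

theorem classPrior_add {X : Type*} [MeasurableSpace X] (D : Measure (X × ℤˣ))
    [IsProbabilityMeasure D] : classPrior D 1 + classPrior D (-1) = 1 := by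
  have hms : MeasurableSet {p : X × ℤˣ | p.2 = 1} := measurable_snd (.singleton 1)
  have hc : {p : X × ℤˣ | p.2 = 1}ᶜ = {p | p.2 = -1} := by
    ext p
    rcases Int.units_eq_one_or p.2 with h | h <;> simp [h]
  rw [classPrior, classPrior, ← hc]
  exact probReal_add_probReal_compl hms

theorem classPrior_nonneg {X : Type*} [MeasurableSpace X] (D : Measure (X × ℤˣ)) (t : ℤˣ) :
    0 ≤ classPrior D t := measureReal_nonneg

theorem acceptedPairs_eq (X : Type*) : acceptedPairs X
    = ({p : X × ℤˣ | p.2 = -1} ×ˢ {p : X × ℤˣ | p.2 = 1})ᶜ := by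
  ext q
  have h : (1 : ℤˣ) ≠ -1 := by decide
  have h' : (-1 : ℤˣ) ≠ 1 := by decide
  rcases Int.units_eq_one_or q.1.2 with h1 | h1 <;> rcases Int.units_eq_one_or q.2.2 with h2 | h2 <;>
    simp [acceptedPairs, h1, h2, h, h']

theorem measurableSet_label {X : Type*} [MeasurableSpace X] (t : ℤˣ) :
    MeasurableSet {p : X × ℤˣ | p.2 = t} := measurable_snd (.singleton t)

theorem measureReal_acceptedPairs {X : Type*} [MeasurableSpace X] (D : Measure (X × ℤˣ))
    [IsProbabilityMeasure D] :
    (D.prod D).real (acceptedPairs X) = 1 - classPrior D 1 * classPrior D (-1) := by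
  rw [acceptedPairs_eq, probReal_compl_eq_one_sub
    ((measurableSet_label (-1)).prod (measurableSet_label 1)), measureReal_prod_prod, mul_comm]
  rfl

theorem one_sub_classPrior_mul_pos {X : Type*} [MeasurableSpace X] (D : Measure (X × ℤˣ))
    [IsProbabilityMeasure D] : 0 < 1 - classPrior D 1 * classPrior D (-1) := by
  nlinarith [classPrior_add D, sq_nonneg (classPrior D 1 - classPrior D (-1))]

instance isProbabilityMeasure_pairLaw {X : Type*} [MeasurableSpace X] (D : Measure (X × ℤˣ))
    [IsProbabilityMeasure D] : IsProbabilityMeasure (pairLaw D) := by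
  have h0 : (D.prod D) (acceptedPairs X) ≠ 0 := fun h => by
    have h1 := measureReal_acceptedPairs D
    rw [measureReal_def, h] at h1
    have h2 := one_sub_classPrior_mul_pos D
    simp only [ENNReal.toReal_zero] at h1
    linarith
  have := cond_isProbabilityMeasure h0
  exact Measure.isProbabilityMeasure_map (by fun_prop)

instance isProbabilityMeasure_posLaw {X : Type*} [MeasurableSpace X] (D : Measure (X × ℤˣ))
    [IsProbabilityMeasure D] : IsProbabilityMeasure (posLaw D) :=
  Measure.isProbabilityMeasure_map (by fun_prop)

instance isProbabilityMeasure_negLaw {X : Type*} [MeasurableSpace X] (D : Measure (X × ℤˣ))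
    [IsProbabilityMeasure D] : IsProbabilityMeasure (negLaw D) :=
  Measure.isProbabilityMeasure_map (by fun_prop)

theorem integral_pairLaw {X : Type*} [MeasurableSpace X] (D : Measure (X × ℤˣ))
    [IsProbabilityMeasure D] {u : X × X → ℝ} {B : ℝ} (hu : Measurable u) (hB : ∀ z, |u z| ≤ B) :
    (1 - classPrior D 1 * classPrior D (-1)) * ∫ z, u z ∂(pairLaw D)
      = ∫ q, u (q.1.1, q.2.1) ∂(D.prod D)
        - ∫ q in {p : X × ℤˣ | p.2 = -1} ×ˢ {p : X × ℤˣ | p.2 = 1},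
            u (q.1.1, q.2.1) ∂(D.prod D) := by
  have hms := (measurableSet_label (X := X) (-1)).prod (measurableSet_label (X := X) 1)
  have hqm : Measurable fun q : (X × ℤˣ) × (X × ℤˣ) => u (q.1.1, q.2.1) := hu.comp (by fun_prop)
  have hqi : Integrable (fun q : (X × ℤˣ) × (X × ℤˣ) => u (q.1.1, q.2.1)) (D.prod D) :=
    integrable_of_abs_le hqm fun q => hB _
  rw [← integral_add_compl hms hqi, add_sub_cancel_left, ← acceptedPairs_eq, pairLaw,
    integral_map (by fun_prop) hu.aestronglyMeasurable, ProbabilityTheory.cond,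
    integral_smul_measure, ← measureReal_acceptedPairs, ENNReal.toReal_inv, smul_eq_mul,
    ← mul_assoc, measureReal_def, mul_inv_cancel₀, one_mul]
  rw [← measureReal_def, measureReal_acceptedPairs]
  exact (one_sub_classPrior_mul_pos D).ne'

theorem integral_eq_add_label {X : Type*} [MeasurableSpace X] {D : Measure (X × ℤˣ)}
    {v : X × ℤˣ → ℝ} (hv : Integrable v D) :
    ∫ p, v p ∂D = ∫ p in {p | p.2 = 1}, v p ∂D + ∫ p in {p | p.2 = -1}, v p ∂D := by
  rw [← integral_add_compl (measurableSet_label 1) hv]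
  congr 3
  ext p
  rcases Int.units_eq_one_or p.2 with h | h <;> simp [h]

/-- Up to normalization, the first component of a comparison has the law
`π₊ p₊ + π₋² p₋`. -/
theorem integral_posLaw {X : Type*} [MeasurableSpace X] (D : Measure (X × ℤˣ))
    [IsProbabilityMeasure D] {u : X → ℝ} {B : ℝ} (hu : Measurable u) (hB : ∀ x, |u x| ≤ B) :
    (1 - classPrior D 1 * classPrior D (-1)) * ∫ x, u x ∂(posLaw D)
      = ∫ p in {p | p.2 = 1}, u p.1 ∂D
        + classPrior D (-1) * ∫ p in {p | p.2 = -1}, u p.1 ∂D := by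
  have hi : Integrable (fun p : X × ℤˣ => u p.1) D :=
    integrable_of_abs_le (hu.comp measurable_fst) fun p => hB _
  have h1 : ∫ q, u q.1.1 ∂(D.prod D) = ∫ p, u p.1 ∂D := by
    have := integral_prod_mul (μ := D) (ν := D) (fun p => u p.1) fun _ => (1 : ℝ)
    simpa using this
  have h2 : ∫ q in {p : X × ℤˣ | p.2 = -1} ×ˢ {p : X × ℤˣ | p.2 = 1}, u q.1.1 ∂(D.prod D)
      = (∫ p in {p | p.2 = -1}, u p.1 ∂D) * classPrior D 1 := by
    have := setIntegral_prod_mul (μ := D) (ν := D) (fun p => u p.1) (fun _ => (1 : ℝ))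
      {p : X × ℤˣ | p.2 = -1} {p : X × ℤˣ | p.2 = 1}
    simpa [classPrior] using this
  rw [posLaw, integral_map (by fun_prop) hu.aestronglyMeasurable,
    integral_pairLaw D (u := fun z => u z.1) (hu.comp measurable_fst) fun z => hB _]
  show ∫ q, u q.1.1 ∂(D.prod D) - ∫ q in _ ×ˢ _, u q.1.1 ∂(D.prod D) = _
  rw [h1, h2, integral_eq_add_label hi]
  linear_combination (-∫ p in {p | p.2 = -1}, u p.1 ∂D) * classPrior_add D

/-- Up to normalization, the second component of a comparison has the law
`π₋ p₋ + π₊² p₊`. -/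
theorem integral_negLaw {X : Type*} [MeasurableSpace X] (D : Measure (X × ℤˣ))
    [IsProbabilityMeasure D] {u : X → ℝ} {B : ℝ} (hu : Measurable u) (hB : ∀ x, |u x| ≤ B) :
    (1 - classPrior D 1 * classPrior D (-1)) * ∫ x, u x ∂(negLaw D)
      = ∫ p in {p | p.2 = -1}, u p.1 ∂D
        + classPrior D 1 * ∫ p in {p | p.2 = 1}, u p.1 ∂D := by
  have hi : Integrable (fun p : X × ℤˣ => u p.1) D :=
    integrable_of_abs_le (hu.comp measurable_fst) fun p => hB _
  have h1 : ∫ q, u q.2.1 ∂(D.prod D) = ∫ p, u p.1 ∂D := by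
    have := integral_prod_mul (μ := D) (ν := D) (fun _ => (1 : ℝ)) fun p => u p.1
    simpa using this
  have h2 : ∫ q in {p : X × ℤˣ | p.2 = -1} ×ˢ {p : X × ℤˣ | p.2 = 1}, u q.2.1 ∂(D.prod D)
      = classPrior D (-1) * ∫ p in {p | p.2 = 1}, u p.1 ∂D := by
    have := setIntegral_prod_mul (μ := D) (ν := D) (fun _ => (1 : ℝ)) (fun p => u p.1)
      {p : X × ℤˣ | p.2 = -1} {p : X × ℤˣ | p.2 = 1}
    simpa [classPrior] using this
  rw [negLaw, integral_map (by fun_prop) hu.aestronglyMeasurable,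
    integral_pairLaw D (u := fun z => u z.2) (hu.comp measurable_snd) fun z => hB _]
  show ∫ q, u q.2.1 ∂(D.prod D) - ∫ q in _ ×ˢ _, u q.2.1 ∂(D.prod D) = _
  rw [h1, h2, integral_eq_add_label hi]
  linear_combination (-∫ p in {p | p.2 = 1}, u p.1 ∂D) * classPrior_add D

/-! ### Unbiasedness of the empirical risk -/

/-- The corrected loss `ℓ(·, t) - π_t ℓ(·, -t)` charged to the component of a comparison whose
nominal label is `t`. -/
noncomputable def correctedLoss {X : Type*} [MeasurableSpace X] (D : Measure (X × ℤˣ))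
    (l : ℝ → ℤˣ → ℝ) (t : ℤˣ) (z : ℝ) : ℝ :=
  l z t - classPrior D t * l z (-t)

/-- The summand of the empirical risk that one comparison contributes. -/
noncomputable def pairLoss {X : Type*} [MeasurableSpace X] (D : Measure (X × ℤˣ)) (l : ℝ → ℤˣ → ℝ)
    (f : X → ℝ) (z : X × X) : ℝ :=
  correctedLoss D l 1 (f z.1) + correctedLoss D l (-1) (f z.2)

theorem empRisk_eq {X : Type*} [MeasurableSpace X] (D : Measure (X × ℤˣ)) (l : ℝ → ℤˣ → ℝ)
    {n : ℕ} (S : Fin n → X × X) (f : X → ℝ) :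
    empRisk D l S f = (1 / (n : ℝ)) * ∑ k, pairLoss D l f (S k) := by
  rw [empRisk]
  congr 1
  refine Finset.sum_congr rfl fun k _ => ?_
  simp only [pairLoss, correctedLoss, neg_neg]
  ring

theorem lipschitzWith_correctedLoss {X : Type*} [MeasurableSpace X] (D : Measure (X × ℤˣ))
    {l : ℝ → ℤˣ → ℝ} {ρ : ℝ≥0} (hl : ∀ t, LipschitzWith ρ fun z => l z t) (t : ℤˣ) :
    LipschitzWith ((1 + (classPrior D t).toNNReal) * ρ) (correctedLoss D l t) := by
  refine LipschitzWith.of_dist_le_mul fun x y => ?_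
  have h1 := (hl t).dist_le_mul x y
  have h2 := mul_le_mul_of_nonneg_left ((hl (-t)).dist_le_mul x y) (classPrior_nonneg D t)
  rw [Real.dist_eq] at h1 h2
  rw [Real.dist_eq, correctedLoss, correctedLoss,
    show l x t - classPrior D t * l x (-t) - (l y t - classPrior D t * l y (-t))
      = (l x t - l y t) - classPrior D t * (l x (-t) - l y (-t)) by ring]
  refine (abs_sub _ _).trans ?_
  rw [abs_mul, abs_of_nonneg (classPrior_nonneg D t)]
  push_cast
  rw [Real.coe_toNNReal _ (classPrior_nonneg D t)]
  linarith

theorem correctedLoss_mem_Icc {X : Type*} [MeasurableSpace X] (D : Measure (X × ℤˣ))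
    {l : ℝ → ℤˣ → ℝ} {C z : ℝ} (h0 : ∀ t, 0 ≤ l z t) (hC : ∀ t, l z t ≤ C) (t : ℤˣ) :
    correctedLoss D l t z ∈ Set.Icc (-(classPrior D t * C)) C := by
  have hp := classPrior_nonneg D t
  have h1 := mul_le_mul_of_nonneg_left (hC (-t)) hp
  have h2 := mul_nonneg hp (h0 (-t))
  constructor <;> rw [correctedLoss] <;> linarith [h0 t, hC t]

theorem abs_correctedLoss_le {X : Type*} [MeasurableSpace X] (D : Measure (X × ℤˣ))
    [IsProbabilityMeasure D] {l : ℝ → ℤˣ → ℝ} {C z : ℝ} (h0 : ∀ t, 0 ≤ l z t)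
    (hC : ∀ t, l z t ≤ C) (t : ℤˣ) : |correctedLoss D l t z| ≤ C := by
  obtain ⟨h1, h2⟩ := correctedLoss_mem_Icc D h0 hC t
  have hp : classPrior D t ≤ 1 := measureReal_le_one
  have := mul_le_mul_of_nonneg_right hp ((h0 1).trans (hC 1))
  exact abs_le.2 ⟨by linarith, h2⟩

/-- The pairwise comparison risk is unbiased: the corrected losses invert the mixing of the two
class-conditional laws. -/
theorem integral_pairLoss {X : Type*} [MeasurableSpace X] (D : Measure (X × ℤˣ))
    [IsProbabilityMeasure D] {l : ℝ → ℤˣ → ℝ} {C : ℝ} (hl : ∀ t, Measurable fun z => l z t)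
    {f : X → ℝ} (hf : Measurable f) (h0 : ∀ x t, 0 ≤ l (f x) t) (hC : ∀ x t, l (f x) t ≤ C) :
    ∫ z, pairLoss D l f z ∂(pairLaw D) = risk D l f := by
  have hlm : ∀ t, Measurable fun x => l (f x) t := fun t => (hl t).comp hf
  have hlB : ∀ t x, |l (f x) t| ≤ C := fun t x => by rw [abs_of_nonneg (h0 x t)]; exact hC x t
  have hli : ∀ t s, Integrable (fun p : X × ℤˣ => l (f p.1) t) (D.restrict {p | p.2 = s}) :=
    fun t s => integrable_of_abs_le ((hlm t).comp measurable_fst) fun p => hlB t _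
  have hcm : ∀ t, Measurable fun x => correctedLoss D l t (f x) := fun t =>
    (hlm t).sub ((hlm (-t)).const_mul _)
  have hcB : ∀ t x, |correctedLoss D l t (f x)| ≤ C := fun t x =>
    abs_correctedLoss_le D (h0 x) (hC x) t
  have hsplit : ∀ t s, ∫ p in {p : X × ℤˣ | p.2 = s}, correctedLoss D l t (f p.1) ∂D
      = ∫ p in {p : X × ℤˣ | p.2 = s}, l (f p.1) t ∂D
        - classPrior D t * ∫ p in {p : X × ℤˣ | p.2 = s}, l (f p.1) (-t) ∂D := fun t s => by
    simp only [correctedLoss]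
    rw [integral_sub (hli t s) ((hli (-t) s).const_mul _), integral_const_mul]
  have hpair : ∫ z, pairLoss D l f z ∂(pairLaw D)
      = ∫ x, correctedLoss D l 1 (f x) ∂(posLaw D)
        + ∫ x, correctedLoss D l (-1) (f x) ∂(negLaw D) := by
    rw [posLaw, negLaw, integral_map (by fun_prop) (hcm 1).aestronglyMeasurable,
      integral_map (by fun_prop) (hcm (-1)).aestronglyMeasurable]
    exact integral_add (integrable_of_abs_le ((hcm 1).comp measurable_fst) fun z => hcB _ _)
      (integrable_of_abs_le ((hcm (-1)).comp measurable_snd) fun z => hcB _ _)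
  have hrisk : risk D l f = ∫ p in {p : X × ℤˣ | p.2 = 1}, l (f p.1) 1 ∂D
      + ∫ p in {p : X × ℤˣ | p.2 = -1}, l (f p.1) (-1) ∂D := by
    have hjm : Measurable fun p : X × ℤˣ => l (f p.1) p.2 :=
      measurable_from_prod_countable_left fun t => hlm t
    rw [risk, integral_eq_add_label (integrable_of_abs_le hjm fun p => hlB _ _)]
    congr 1 <;> exact setIntegral_congr_fun (measurableSet_label _) fun p (hp : p.2 = _) => by
      simp only [hp]
  have e1 := integral_posLaw D (hcm 1) (hcB 1)
  have e2 := integral_negLaw D (hcm (-1)) (hcB (-1))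
  simp only [hsplit, neg_neg] at e1 e2
  refine mul_left_cancel₀ (one_sub_classPrior_mul_pos D).ne' ?_
  rw [hpair, hrisk, mul_add, e1, e2]
  ring

/-! ### Excess risk -/

theorem le_lossSup {l : ℝ → ℤˣ → ℝ} {ρ : ℝ≥0} (hl : ∀ t, LipschitzWith ρ fun z => l z t)
    {C z : ℝ} (hz : |z| ≤ C) (t : ℤˣ) : l z t ≤ lossSup l C := by
  refine le_csSup ⟨max (l 0 1) (l 0 (-1)) + ρ * C, ?_⟩ ⟨z, t, hz, rfl⟩
  rintro _ ⟨y, s, hy, rfl⟩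
  have h1 := (le_abs_self _).trans ((hl s).dist_le_mul y 0)
  rw [Real.dist_eq, sub_zero] at h1
  have h2 := mul_le_mul_of_nonneg_left hy ρ.2
  have h3 : l 0 s ≤ max (l 0 1) (l 0 (-1)) := by
    rcases Int.units_eq_one_or s with h | h <;> simp [h]
  have h4 : (ρ : ℝ) * |y| ≤ ρ * C := h2
  linarith

/-- A measurable majorant of the deviations `risk - empRisk` over the class, with integral at most
twice the Rademacher complexities of the two corrected loss classes, up to `η`. -/
theorem exists_measurable_majorant_risk_deviation {X : Type*} [MeasurableSpace X]
    (D : Measure (X × ℤˣ)) [IsProbabilityMeasure D] {l : ℝ → ℤˣ → ℝ} {ρ : ℝ≥0}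
    (hl : ∀ t, LipschitzWith ρ fun z => l z t) {F : Set (X → ℝ)} (hF : F.Nonempty)
    (hFm : ∀ f ∈ F, Measurable f) {Cb C : ℝ} (hCb : ∀ f ∈ F, ∀ x, |f x| ≤ Cb)
    (h0 : ∀ f ∈ F, ∀ x t, 0 ≤ l (f x) t) (hC : ∀ f ∈ F, ∀ x t, l (f x) t ≤ C) {n : ℕ} (hn : 1 ≤ n)
    (hpos : RademacherMeasurable (posLaw D) n F) (hneg : RademacherMeasurable (negLaw D) n F)
    {η : ℝ} (hη : 0 < η) :
    ∃ W : (Fin n → X × X) → ℝ, Measurable W ∧ (∃ A, ∀ S, |W S| ≤ A) ∧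
      (∀ f : F, ∀ S, ∫ z, pairLoss D l f.1 z ∂(pairLaw D)
        - (1 / (n : ℝ)) * ∑ k, pairLoss D l f.1 (S k) ≤ W S) ∧
      ∫ S, W S ∂(Measure.pi fun _ : Fin n => pairLaw D)
        ≤ 2 * ((1 + classPrior D 1) * ρ * rademacher (posLaw D) n F
          + (1 + classPrior D (-1)) * ρ * rademacher (negLaw D) n F) + η := by
  have hcB : ∀ t, ∀ f ∈ F, ∀ x, |correctedLoss D l t (f x)| ≤ C := fun t f hf x =>
    abs_correctedLoss_le D (h0 f hf x) (hC f hf x) t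
  have hφ := lipschitzWith_correctedLoss D hl
  obtain ⟨U, hUm, hUge, hUB, hU⟩ := exists_measurable_majorant_rademacher hn hF hCb hpos (hφ 1)
    (hcB 1) (η := η / 4) (by positivity)
  obtain ⟨V, hVm, hVge, hVB, hV⟩ := exists_measurable_majorant_rademacher hn hF hCb hneg (hφ (-1))
    (hcB (-1)) (η := η / 4) (by positivity)
  have p1 : MeasurePreserving (fun (S : Fin n → X × X) k => (S k).1)
      (Measure.pi fun _ : Fin n => pairLaw D) (Measure.pi fun _ : Fin n => posLaw D) :=
    measurePreserving_pi _ _ fun _ => ⟨measurable_fst, rfl⟩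
  have p2 : MeasurePreserving (fun (S : Fin n → X × X) k => (S k).2)
      (Measure.pi fun _ : Fin n => pairLaw D) (Measure.pi fun _ : Fin n => negLaw D) :=
    measurePreserving_pi _ _ fun _ => ⟨measurable_snd, rfl⟩
  have m1 : ∀ ε, Measurable fun S : Fin n → X × X => U ε fun k => (S k).1 := fun ε =>
    (hUm ε).comp p1.measurable
  have m2 : ∀ ε, Measurable fun S : Fin n → X × X => V ε fun k => (S k).2 := fun ε =>
    (hVm ε).comp p2.measurable
  have i1 : ∀ ε, ∫ S, U ε (fun k => (S k).1) ∂(Measure.pi fun _ : Fin n => pairLaw D)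
      = ∫ x, U ε x ∂(Measure.pi fun _ : Fin n => posLaw D) := fun ε => by
    refine (integral_map p1.measurable.aemeasurable (hUm ε).aestronglyMeasurable).symm.trans ?_
    rw [p1.map_eq]
  have i2 : ∀ ε, ∫ S, V ε (fun k => (S k).2) ∂(Measure.pi fun _ : Fin n => pairLaw D)
      = ∫ x, V ε x ∂(Measure.pi fun _ : Fin n => negLaw D) := fun ε => by
    refine (integral_map p2.measurable.aemeasurable (hVm ε).aestronglyMeasurable).symm.trans ?_
    rw [p2.map_eq]
  have hcm : ∀ t, ∀ f ∈ F, Measurable fun x => correctedLoss D l t (f x) := fun t f hf =>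
    (hφ t).continuous.measurable.comp (hFm f hf)
  obtain ⟨W, hWm, hWA, hWge, hW⟩ := exists_measurable_majorant_deviation (μ := pairLaw D)
    (ι := F) (B := C + C) (A := C + C) hn (h := fun f => pairLoss D l f.1)
    (fun f => ((hcm 1 f.1 f.2).comp measurable_fst).add ((hcm (-1) f.1 f.2).comp measurable_snd))
    (fun f z => (abs_add_le _ _).trans (add_le_add (hcB 1 f.1 f.2 _) (hcB (-1) f.1 f.2 _)))
    (N := fun ε S => U ε (fun k => (S k).1) + V ε fun k => (S k).2)
    (fun ε => (m1 ε).add (m2 ε))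
    (fun ε S => (abs_add_le _ _).trans (add_le_add (hUB ε _) (hVB ε _)))
    (fun ε f S => by
      refine le_trans (le_of_eq ?_) (add_le_add (hUge ε f.1 f.2 _) (hVge ε f.1 f.2 _))
      rw [← mul_add, ← Finset.sum_add_distrib]
      simp only [pairLoss, mul_add])
  refine ⟨W, hWm, hWA, hWge, ?_⟩
  have hN : ∀ ε, ∫ S, (U ε (fun k => (S k).1) + V ε fun k => (S k).2)
      ∂(Measure.pi fun _ : Fin n => pairLaw D)
      = ∫ x, U ε x ∂(Measure.pi fun _ : Fin n => posLaw D)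
        + ∫ x, V ε x ∂(Measure.pi fun _ : Fin n => negLaw D) := fun ε => by
    rw [integral_add (integrable_of_abs_le (m1 ε) fun S => hUB ε _)
      (integrable_of_abs_le (m2 ε) fun S => hVB ε _), i1, i2]
  rw [hW]
  simp only [hN]
  rw [Finset.sum_add_distrib, mul_add]
  push_cast at hU hV
  rw [Real.coe_toNNReal _ (classPrior_nonneg D _)] at hU hV
  linarith

end Pcomp

theorem theorem4 {X : Type*} [MeasurableSpace X]
    (D : Measure (X × ℤˣ)) [IsProbabilityMeasure D]
    (l : ℝ → ℤˣ → ℝ) (hl_nonneg : ∀ z t, 0 ≤ l z t)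
    (ρ : ℝ≥0) (hl_lip : ∀ t, LipschitzWith ρ (fun z => l z t))
    (F : Set (X → ℝ)) (hF_meas : ∀ f ∈ F, Measurable f)
    (Cb : ℝ) (hCb : 0 < Cb) (hF_bdd : ∀ f ∈ F, ∀ x, |f x| ≤ Cb)
    (n : ℕ) (hn : 1 ≤ n)
    (hpos : Pcomp.RademacherMeasurable (Pcomp.posLaw D) n F)
    (hneg : Pcomp.RademacherMeasurable (Pcomp.negLaw D) n F)
    (fstar : X → ℝ) (hfstar : Pcomp.IsArgmin F (Pcomp.risk D l) fstar)
    (δ : ℝ) (hδ : 0 < δ) :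
    ∃ G : Set (Fin n → X × X), MeasurableSet G ∧ 1 - δ ≤ (Pcomp.sampleLaw D n).real G ∧
      ∀ S ∈ G, ∀ fhat : X → ℝ, Pcomp.IsArgmin F (Pcomp.empRisk D l S) fhat →
        Pcomp.risk D l fhat - Pcomp.risk D l fstar ≤
          (1 + Pcomp.classPrior D 1) * 4 * ρ * Pcomp.rademacher (Pcomp.posLaw D) n F
          + (1 + Pcomp.classPrior D (-1)) * 4 * ρ * Pcomp.rademacher (Pcomp.negLaw D) n F
          + 6 * Pcomp.lossSup l Cb * √(Real.log (8 / δ) / (2 * n)) := by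
  have hF : F.Nonempty := ⟨fstar, hfstar.1⟩
  set C := Pcomp.lossSup l Cb
  have h0 : ∀ f ∈ F, ∀ x t, 0 ≤ l (f x) t := fun f _ x t => hl_nonneg _ _
  have hC : ∀ f ∈ F, ∀ x t, l (f x) t ≤ C := fun f hf x t =>
    Pcomp.le_lossSup hl_lip (hF_bdd f hf x) t
  have hC0 : 0 ≤ C := (hl_nonneg 0 1).trans (Pcomp.le_lossSup hl_lip (by simpa using hCb.le) 1)
  have hn0 : (0 : ℝ) < n := by exact_mod_cast hn
  have hR1 := Pcomp.rademacher_nonneg hF hF_bdd hpos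
  have hR2 := Pcomp.rademacher_nonneg hF hF_bdd hneg
  have hp1 := Pcomp.classPrior_nonneg D 1
  have hp2 := Pcomp.classPrior_nonneg D (-1)
  set R := (1 + Pcomp.classPrior D 1) * ρ * Pcomp.rademacher (Pcomp.posLaw D) n F
    + (1 + Pcomp.classPrior D (-1)) * ρ * Pcomp.rademacher (Pcomp.negLaw D) n F with hRdef
  have hR0 : 0 ≤ R := by positivity
  set s := √(Real.log (8 / δ) / (2 * n)) with hs
  have hs0 : 0 ≤ s := Real.sqrt_nonneg _
  have hrhs : (1 + Pcomp.classPrior D 1) * 4 * ρ * Pcomp.rademacher (Pcomp.posLaw D) n F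
      + (1 + Pcomp.classPrior D (-1)) * 4 * ρ * Pcomp.rademacher (Pcomp.negLaw D) n F
      + 6 * C * s = 4 * R + 6 * C * s := by rw [hRdef]; ring
  simp only [hrhs]
  rcases le_or_gt 1 δ with hδ1 | hδ1
  · exact ⟨∅, .empty, by simpa using hδ1, fun S hS => hS.elim⟩
  rcases hC0.eq_or_lt with hCz | hCpos
  · -- McDiarmid's bound is void for differences bounded by `0`, where its exponent divides by `0`.
    -- If `C = 0`, however, all risks over `F` vanish.
    refine ⟨Set.univ, .univ, ?_, fun S _ fhat hfhat => ?_⟩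
    · have : IsProbabilityMeasure (Pcomp.sampleLaw D n) := by
        unfold Pcomp.sampleLaw; infer_instance
      rw [probReal_univ]
      linarith
    · have hz : ∀ f ∈ F, Pcomp.risk D l f = 0 := fun f hf => by
        have : ∀ p : X × ℤˣ, l (f p.1) p.2 = 0 := fun p =>
          le_antisymm ((hC f hf _ _).trans hCz.ge) (hl_nonneg _ _)
        simp [Pcomp.risk, this]
      rw [hz _ hfhat.1, hz _ hfstar.1]
      have := mul_nonneg (mul_nonneg (by norm_num : (0 : ℝ) ≤ 6) hC0) hs0
      linarith
  have hlm : ∀ t, Measurable fun z => l z t := fun t => (hl_lip t).continuous.measurable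
  have hrisk : ∀ f ∈ F, ∫ z, Pcomp.pairLoss D l f z ∂(Pcomp.pairLaw D) = Pcomp.risk D l f :=
    fun f hf => Pcomp.integral_pairLoss D hlm (hF_meas f hf) (h0 f hf) (hC f hf)
  have hB : ∀ f ∈ F, ∀ z, |Pcomp.pairLoss D l f z| ≤ C + C := fun f hf z =>
    (abs_add_le _ _).trans (add_le_add (Pcomp.abs_correctedLoss_le D (h0 f hf _) (hC f hf _) 1)
      (Pcomp.abs_correctedLoss_le D (h0 f hf _) (hC f hf _) (-1)))
  obtain ⟨c, hc⟩ : ∃ c : ℝ≥0, (c : ℝ) = 3 * C := ⟨⟨3 * C, by positivity⟩, rfl⟩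
  -- The two corrected losses have ranges of length `(1 + π₊) C` and `(1 + π₋) C`.
  have hosc : ∀ f ∈ F, ∀ y z, Pcomp.pairLoss D l f y - Pcomp.pairLoss D l f z ≤ c :=
      fun f hf y z => by
    obtain ⟨-, a1⟩ := Pcomp.correctedLoss_mem_Icc D (h0 f hf y.1) (hC f hf y.1) 1
    obtain ⟨-, a2⟩ := Pcomp.correctedLoss_mem_Icc D (h0 f hf y.2) (hC f hf y.2) (-1)
    obtain ⟨b1, -⟩ := Pcomp.correctedLoss_mem_Icc D (h0 f hf z.1) (hC f hf z.1) 1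
    obtain ⟨b2, -⟩ := Pcomp.correctedLoss_mem_Icc D (h0 f hf z.2) (hC f hf z.2) (-1)
    have hsum := congrArg (· * C) (Pcomp.classPrior_add D)
    simp only [add_mul, one_mul] at hsum
    simp only [hc, Pcomp.pairLoss]
    linarith
  have hlog : 0 < Real.log (8 / δ) := Real.log_pos (by rw [lt_div_iff₀ hδ]; linarith)
  have hexp : Real.exp (-(2 * n * (3 * C * s) ^ 2) / (c : ℝ) ^ 2) = δ / 8 := by
    have hs2 : s ^ 2 = Real.log (8 / δ) / (2 * n) := Real.sq_sqrt (by positivity)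
    have : -(2 * n * (3 * C * s) ^ 2) / (c : ℝ) ^ 2 = -Real.log (8 / δ) := by
      rw [mul_pow (3 * C) s, hs2, hc]
      field_simp
    rw [this, Real.exp_neg, Real.exp_log (by positivity), inv_div]
  have hε : 0 ≤ 3 * C * s := by positivity
  have : Nonempty F := hF.to_subtype
  -- Each of the two deviations exceeds its mean by `3 C s` with probability at most `δ / 8`.
  obtain ⟨G₁, hG₁m, hG₁, hdev₁⟩ := Pcomp.exists_measurableSet_deviation_le hn
    (h := fun f : F => Pcomp.pairLoss D l f.1) (fun f => hB f.1 f.2) (fun f => hosc f.1 f.2)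
    (fun η hη => Pcomp.exists_measurable_majorant_risk_deviation D hl_lip hF hF_meas hF_bdd h0 hC
      hn hpos hneg hη) hε
  have hφm : ∀ t, Measurable fun x => Pcomp.correctedLoss D l t (fstar x) := fun t =>
    (Pcomp.lipschitzWith_correctedLoss D hl_lip t).continuous.measurable.comp
      (hF_meas _ hfstar.1)
  have hlm' : Measurable fun z => -Pcomp.pairLoss D l fstar z :=
    (((hφm 1).comp measurable_fst).add ((hφm (-1)).comp measurable_snd)).neg
  have hB' : ∀ z, |(-Pcomp.pairLoss D l fstar z)| ≤ C + C := fun z => by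
    rw [abs_neg]
    exact hB _ hfstar.1 z
  -- For the single function `fstar` the deviation is its own majorant, of mean zero.
  obtain ⟨G₂, hG₂m, hG₂, hdev₂⟩ := Pcomp.exists_measurableSet_deviation_le (ι := Unit)
    (μ := Pcomp.pairLaw D) hn (h := fun _ z => -Pcomp.pairLoss D l fstar z) (w := 0) (c := c)
    (fun _ => hB') (fun _ y z => by linarith [hosc _ hfstar.1 z y])
    (fun η hη => by
      have he := Pcomp.measurable_empirical_mean n hlm'
      have heB := Pcomp.abs_empirical_mean_le hn hB'
      refine ⟨_, he.const_sub _, ⟨_, fun S => (abs_sub _ _).trans (add_le_add le_rfl (heB S))⟩,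
        fun _ S => le_rfl, ?_⟩
      rw [integral_sub (integrable_const _) (Pcomp.integrable_of_abs_le he heB),
        Pcomp.integral_empirical_mean hn hlm' hB']
      simpa using hη.le) hε
  rw [hexp] at hG₁ hG₂
  refine ⟨G₁ ∩ G₂, hG₁m.inter hG₂m, ?_, fun S hS fhat hfhat => ?_⟩
  · have h1 := measureReal_union_add_inter
      (μ := Measure.pi fun _ : Fin n => Pcomp.pairLaw D) (s := G₁) hG₂m
    have h2 : (Measure.pi fun _ : Fin n => Pcomp.pairLaw D).real (G₁ ∪ G₂) ≤ 1 :=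
      measureReal_le_one
    show 1 - δ ≤ (Measure.pi fun _ : Fin n => Pcomp.pairLaw D).real (G₁ ∩ G₂)
    linarith
  · have h1 := hdev₁ S hS.1 ⟨fhat, hfhat.1⟩
    have h2 := hdev₂ S hS.2 ()
    have h3 := hfhat.2 fstar hfstar.1
    rw [Pcomp.empRisk_eq, Pcomp.empRisk_eq] at h3
    simp only [Finset.sum_neg_distrib, integral_neg, hrisk _ hfstar.1] at h2
    simp only [hrisk _ hfhat.1] at h1
    linarith
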